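/- Let $s$ be the Stern diatomic sequence, $s(0)=0$, $s(1)=1$, $s(2n)=s(n)$, $s(2n+1)=s(n)+s(n+1)$. For $N\ge 1$ let $\mathbb P_N$ be the uniform probability measure on the integers $n\in[2^N,2^{N+1})$, with expectation $\mathbb E_N$ and variance $\operatorname{Var}_N$, and let $S_N$ be the random variable $S_N=s(n)$. There exist constants $\alpha,\sigma>0$ such that the values $\log s(n)$ are asymptotically distributed according to a Gaussian law with mean $\alpha N$ and variance $\sigma^2N$, in the following sense: for every $K>0$ there is a constant $C$, depending only on $K$, such that for all $N\ge 1$ and all real $t$ with $|t|\le K N^{1/6}$, $$\left|\mathbb P_N\left[\frac{\log S_N-\alpha N}{\sigma\sqrt N}\le t\right]-\int_{-\infty}^t\frac{e^{-v^2/2}}{\sqrt{2\pi}}\,dv\right|\le C\,\frac{(1+t^2)e^{-t^2/2}}{\sqrt N}.$$ Moreover, with the same $\alpha,\sigma$, there exist real numbers $\nu_1,\nu_2$ and $\theta\in[0,1)$ such that, uniformly for $N\ge 1$, $$\mathbb E_N[\log S_N]=\alpha N+\nu_1+O(\theta^N),\qquad \operatorname{Var}_N[\log S_N]=\sigma^2N+\nu_2+O(N\theta^N).$$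 -/

import Mathlib

open MeasureTheory ProbabilityTheory

/-- The Stern diatomic sequence: `s 0 = 0`, `s 1 = 1`, `s (2 n) = s n` and
`s (2 n + 1) = s n + s (n + 1)`. -/
def stern : ℕ → ℕ
  | 0 => 0
  | 1 => 1
  | n + 2 =>
    if n % 2 = 0 then stern (n / 2 + 1) else stern (n / 2 + 1) + stern (n / 2 + 2)
decreasing_by all_goals omega

theorem stern_zero : stern 0 = 0 := by rw [stern]

theorem stern_one : stern 1 = 1 := by rw [stern]

theorem stern_two_mul (n : ℕ) : stern (2 * n) = stern n := by
  obtain _ | n := n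
  · rfl
  · rw [show 2 * (n + 1) = 2 * n + 2 by ring, stern, if_pos (by omega)]
    congr 1
    omega

theorem stern_two_mul_add_one (n : ℕ) :
    stern (2 * n + 1) = stern n + stern (n + 1) := by
  obtain _ | n := n
  · simp [stern_zero]
  · rw [show 2 * (n + 1) + 1 = (2 * n + 1) + 2 by ring, stern, if_neg (by omega),
      show (2 * n + 1) / 2 = n by omega]

/-- The uniform probability measure on the integers of `[2 ^ N, 2 ^ (N + 1))`. -/
noncomputable def dyadicUniform (N : ℕ) : Measure ℕ :=
  uniformOn (Set.Ico (2 ^ N) (2 ^ (N + 1)))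

instance dyadicUniform_isProbabilityMeasure (N : ℕ) :
    IsProbabilityMeasure (dyadicUniform N) :=
  isProbabilityMeasure_uniformOn (Set.finite_Ico _ _)
    ⟨2 ^ N, le_refl _, Nat.pow_lt_pow_right (by norm_num) (Nat.lt_succ_self N)⟩

/-- The random variable `log S_N`, where `S_N = s(n)`. -/
noncomputable def logStern (n : ℕ) : ℝ := Real.log (stern n)

/-! ### Dyadic sums over the Stern sequence -/

/-! Read `n` digit by digit. The pair `(s(k), s(k+1))` has sum `s(2k+1)` and direction `x =
s(k)/s(2k+1)` in `[0,1]`. Appending the digit 0 sends `x` to `x/(1+x)` and multiplies the sum by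
`1+x`; appending 1 sends `x` to `1/(2-x)` and multiplies it by `2-x`. Trailing zeros do not change
`s`, so `S_N` has the law of `s(2n+1)` for `n` uniform in `[0,2^N)`: its logarithm is an additive
cocycle over `N` fair coin tosses started at `x = 0`, and `E[S_N^z]` is the `N`-th iterate of a
transfer operator applied to 1, evaluated at 0.

Each branch has slope 1 at one endpoint, but the two slopes add up to at most 5/4
(`contraction_sum`), so the branches contract on average. For small complex `z` the iterates
normalized at 0 therefore converge geometrically in the Lipschitz seminorm (`normalized_mgf`).
Summing the logarithms of successive ratios gives `E[S_N^z] = exp(N Λ(z) + R_N(z))` with holomorphic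
terms and `R_N` converging geometrically (`sternMgf_quasi_power`); no spectral theory is needed.
Cauchy estimates at `z = 0` yield the mean and the variance, with `α = Λ'(0)` and `σ² = Λ''(0)`.

Positivity is elementary. The product `(1+x)(2-x)` is at least 2, so the mean gains at least `(log
2)/2` per step. Near `x = 0` the first digit shifts the conditional mean by a definite amount, and
19 zeros bring any state near 0, so the variance gains a fixed amount every 20 steps
(`sternVar_linear_lower`).

The Gaussian estimate is Cramér's method. Tilting the standardized law by `exp(t x)` moves the point
`t` to the centre. Esseen's smoothing inequality, proved with the Fejér kernel, compares the tilted
law with the standard Gaussian, and undoing the tilt produces the factor `exp(-t²/2)`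
(`abs_cdf_sub_gaussian_le_of_laplace`). The range `|t| ≤ K N^(1/6)` is where the cubic error
`|t|³/√N` stays bounded (`cramer_of_quasi_power`). -/

theorem stern_pos {n : ℕ} (hn : 0 < n) : 0 < stern n := by
  induction n using Nat.strong_induction_on with
  | _ n ih =>
    obtain ⟨m, rfl | rfl⟩ := Nat.even_or_odd' n
    · rw [stern_two_mul]
      exact ih m (by omega) (by omega)
    · rw [stern_two_mul_add_one]
      have := ih (m + 1)
      rcases Nat.eq_zero_or_pos m with rfl | hm
      · simp [stern_one]
      · have := ih m (by omega) hm
        omega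

/-- The sum of `g` over the integers whose binary expansion is that of `k` followed by `N` digits. -/
def dyadicSum {E : Type*} [AddCommMonoid E] (g : ℕ → E) (N k : ℕ) : E :=
  ∑ m ∈ Finset.Ico (k * 2 ^ N) ((k + 1) * 2 ^ N), g m

section DyadicSum
variable {E : Type*} [AddCommMonoid E]

theorem dyadicSum_zero (g : ℕ → E) (k : ℕ) : dyadicSum g 0 k = g k := by
  simp [dyadicSum]

theorem dyadicSum_succ (g : ℕ → E) (N k : ℕ) :
    dyadicSum g (N + 1) k = dyadicSum g N (2 * k) + dyadicSum g N (2 * k + 1) := by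
  unfold dyadicSum
  rw [show k * 2 ^ (N + 1) = 2 * k * 2 ^ N by ring,
    show (k + 1) * 2 ^ (N + 1) = (2 * k + 1 + 1) * 2 ^ N by ring]
  rw [Finset.sum_Ico_consecutive]
  · gcongr; omega
  · gcongr; omega

theorem dyadicSum_succ' (g : ℕ → E) (N k : ℕ) :
    dyadicSum g (N + 1) k =
      dyadicSum (fun n ↦ g (2 * n)) N k + dyadicSum (fun n ↦ g (2 * n + 1)) N k := by
  induction N generalizing k with
  | zero => simp [dyadicSum_succ, dyadicSum_zero]
  | succ N ih =>
    rw [dyadicSum_succ, ih, ih, dyadicSum_succ (fun n ↦ g (2 * n)),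
      dyadicSum_succ (fun n ↦ g (2 * n + 1))]
    exact add_add_add_comm _ _ _ _

/-- Halving an even index does not change `s`, so every term reduces to its odd part. In the
induction the left side is split by its last digit and the right side by its first. The gain is a
sum starting from the prefix 0, whose state is `x = 0` with `s(1) = 1`. -/
theorem dyadicSum_stern_one (g : ℕ → E) (N : ℕ) :
    dyadicSum (fun n ↦ g (stern n)) N 1 = dyadicSum (fun n ↦ g (stern (2 * n + 1))) N 0 := by
  induction N with
  | zero => simp [dyadicSum_zero, stern_one]
  | succ N ih =>
    rw [dyadicSum_succ', dyadicSum_succ]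
    simp only [stern_two_mul]
    rw [ih]

end DyadicSum

theorem integrableOn_count_finset {E : Type*} [NormedAddCommGroup E] (s : Finset ℕ) (g : ℕ → E) :
    IntegrableOn g s Measure.count := by
  rw [← (s : Set ℕ).biUnion_of_singleton]
  simp [integrableOn_finset_iUnion]

theorem integral_dyadicUniform {E : Type*} [NormedAddCommGroup E] [NormedSpace ℝ E] [CompleteSpace E]
    (N : ℕ) (g : ℕ → E) :
    ∫ n, g n ∂(dyadicUniform N) = (2 ^ N : ℝ)⁻¹ • dyadicSum g N 1 := by
  have h : ((Finset.Ico (2 ^ N) (2 ^ (N + 1)) : Finset ℕ) : Set ℕ) =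
      Set.Ico (2 ^ N) (2 ^ (N + 1)) := by simp
  rw [dyadicUniform, uniformOn, ProbabilityTheory.cond, integral_smul_measure, ← h,
    Measure.count_apply_finset, setIntegral_finset _ (integrableOn_count_finset _ _)]
  have : 2 ^ (N + 1) - 2 ^ N = 2 ^ N := by rw [pow_succ]; omega
  rw [Nat.card_Ico, this]
  simp [dyadicSum, pow_succ, mul_comm, Measure.real]

theorem integrable_dyadicUniform {E : Type*} [NormedAddCommGroup E]
    (N : ℕ) (g : ℕ → E) : Integrable g (dyadicUniform N) := by
  have h : ((Finset.Ico (2 ^ N) (2 ^ (N + 1)) : Finset ℕ) : Set ℕ) =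
      Set.Ico (2 ^ N) (2 ^ (N + 1)) := by simp
  rw [dyadicUniform, uniformOn, ProbabilityTheory.cond, ← h, Measure.count_apply_finset]
  refine Integrable.smul_measure (integrableOn_count_finset (Finset.Ico (2 ^ N) (2 ^ (N + 1))) g) ?_
  rw [Nat.card_Ico, ENNReal.inv_ne_top]
  exact_mod_cast (Nat.sub_pos_of_lt (Nat.pow_lt_pow_right (by norm_num) N.lt_succ_self)).ne'

/-! ### The cocycle of norm ratios on the unit interval -/

/-- The projective state of `(s k, s (k + 1))`. -/
noncomputable def sternRatio (k : ℕ) : ℝ := stern k / stern (2 * k + 1)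

theorem stern_odd_pos (k : ℕ) : (0 : ℝ) < stern (2 * k + 1) := by
  exact_mod_cast stern_pos (by omega)

theorem sternRatio_mem (k : ℕ) : sternRatio k ∈ Set.Icc (0 : ℝ) 1 := by
  have h := stern_odd_pos k
  refine ⟨by unfold sternRatio; positivity, ?_⟩
  rw [sternRatio, div_le_one h, stern_two_mul_add_one]
  push_cast
  linarith [(stern (k + 1)).cast_nonneg (α := ℝ)]

theorem stern_even_child (k : ℕ) :
    (stern (2 * (2 * k) + 1) : ℝ) = stern (2 * k + 1) * (1 + sternRatio k) := by
  have h := (stern_odd_pos k).ne'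
  rw [sternRatio]
  field_simp
  rw [stern_two_mul_add_one (2 * k), stern_two_mul]
  push_cast
  ring

theorem stern_odd_child (k : ℕ) :
    (stern (2 * (2 * k + 1) + 1) : ℝ) = stern (2 * k + 1) * (2 - sternRatio k) := by
  have h := (stern_odd_pos k).ne'
  rw [sternRatio]
  field_simp
  rw [stern_two_mul_add_one (2 * k + 1), show 2 * k + 1 + 1 = 2 * (k + 1) by ring, stern_two_mul,
    stern_two_mul_add_one]
  push_cast
  ring

theorem sternRatio_even (k : ℕ) : sternRatio (2 * k) = sternRatio k / (1 + sternRatio k) := by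
  have h := (stern_odd_pos k).ne'
  have h1 : 1 + sternRatio k ≠ 0 := by linarith [(sternRatio_mem k).1]
  rw [sternRatio, stern_even_child, stern_two_mul]
  rw [eq_div_iff h1, div_mul_eq_mul_div, mul_div_mul_right _ _ h1, sternRatio]

theorem sternRatio_odd (k : ℕ) : sternRatio (2 * k + 1) = 1 / (2 - sternRatio k) := by
  have h := (stern_odd_pos k).ne'
  have h1 : 2 - sternRatio k ≠ 0 := by linarith [(sternRatio_mem k).2]
  rw [sternRatio, stern_odd_child]
  field_simp

theorem sternRatio_zero : sternRatio 0 = 0 := by simp [sternRatio, stern_zero]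

theorem left_mem {x : ℝ} (hx : x ∈ Set.Icc (0 : ℝ) 1) : x / (1 + x) ∈ Set.Icc (0 : ℝ) 1 := by
  have := hx.1
  exact ⟨by positivity, by rw [div_le_one (by positivity)]; linarith⟩

theorem right_mem {x : ℝ} (hx : x ∈ Set.Icc (0 : ℝ) 1) : 1 / (2 - x) ∈ Set.Icc (0 : ℝ) 1 := by
  have h : 0 < 2 - x := by linarith [hx.2]
  exact ⟨by positivity, by rw [div_le_one h]; linarith [hx.2]⟩

theorem log_stern_even_child (k : ℕ) :
    Real.log (stern (2 * (2 * k) + 1)) =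
      Real.log (stern (2 * k + 1)) + Real.log (1 + sternRatio k) := by
  rw [stern_even_child, Real.log_mul (stern_odd_pos k).ne' (by linarith [(sternRatio_mem k).1])]

theorem log_stern_odd_child (k : ℕ) :
    Real.log (stern (2 * (2 * k + 1) + 1)) =
      Real.log (stern (2 * k + 1)) + Real.log (2 - sternRatio k) := by
  rw [stern_odd_child, Real.log_mul (stern_odd_pos k).ne' (by linarith [(sternRatio_mem k).2])]

/-- The transfer operator of the Stern cocycle, twisted by the `z`-th power of the norm ratio. -/
noncomputable def sternTransfer (z : ℂ) (f : ℝ → ℂ) (x : ℝ) : ℂ :=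
  (Complex.exp (z * Real.log (1 + x)) * f (x / (1 + x)) +
    Complex.exp (z * Real.log (2 - x)) * f (1 / (2 - x))) / 2

/-- The moment generating function of the logarithmic growth in `N` steps from the state `x`. -/
noncomputable def sternMgf (z : ℂ) (N : ℕ) : ℝ → ℂ := (sternTransfer z)^[N] 1

theorem sternMgf_zero (z : ℂ) (x : ℝ) : sternMgf z 0 x = 1 := rfl

theorem sternMgf_succ (z : ℂ) (N : ℕ) : sternMgf z (N + 1) = sternTransfer z (sternMgf z N) := by
  rw [sternMgf, Function.iterate_succ_apply']; rfl

/-- The mean of the logarithmic growth in `N` steps from the state `x`. -/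
noncomputable def sternMean : ℕ → ℝ → ℝ
  | 0, _ => 0
  | N + 1, x => (Real.log (1 + x) + sternMean N (x / (1 + x)) +
      (Real.log (2 - x) + sternMean N (1 / (2 - x)))) / 2

/-- The difference of the conditional means of the logarithmic growth given the first step. -/
noncomputable def sternGap (N : ℕ) (x : ℝ) : ℝ :=
  Real.log (1 + x) + sternMean N (x / (1 + x)) - (Real.log (2 - x) + sternMean N (1 / (2 - x)))

/-- The variance of the logarithmic growth in `N` steps from the state `x`. -/
noncomputable def sternVar : ℕ → ℝ → ℝ
  | 0, _ => 0
  | N + 1, x => (sternVar N (x / (1 + x)) + sternVar N (1 / (2 - x))) / 2 + sternGap N x ^ 2 / 4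

/-- The first appended digit is conditioned upon: the two children of `k` have states given by the
two branches and weights given by the two norm ratios, which is one application of the transfer
operator. -/
theorem dyadicSum_exp_log_stern (z : ℂ) (N k : ℕ) :
    dyadicSum (fun n ↦ Complex.exp (z * Real.log (stern (2 * n + 1)))) N k =
      2 ^ N * (Complex.exp (z * Real.log (stern (2 * k + 1))) * sternMgf z N (sternRatio k)) := by
  induction N generalizing k with
  | zero => simp [dyadicSum_zero, sternMgf_zero]
  | succ N ih =>
    rw [dyadicSum_succ, ih, ih, sternMgf_succ, sternTransfer, log_stern_even_child,
      log_stern_odd_child, sternRatio_even, sternRatio_odd]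
    push_cast
    rw [mul_add, mul_add, Complex.exp_add, Complex.exp_add]
    ring

theorem dyadicSum_log_stern (N k : ℕ) :
    dyadicSum (fun n ↦ Real.log (stern (2 * n + 1))) N k =
      2 ^ N * (Real.log (stern (2 * k + 1)) + sternMean N (sternRatio k)) := by
  induction N generalizing k with
  | zero => simp [dyadicSum_zero, sternMean]
  | succ N ih =>
    rw [dyadicSum_succ, ih, ih, sternMean, log_stern_even_child,
      log_stern_odd_child, sternRatio_even, sternRatio_odd]
    ring

/-- This is the law of total variance. The centre `c` is arbitrary because the two halves of a block
have different means but must be measured about a common point. -/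
theorem dyadicSum_sq_log_stern (c : ℝ) (N k : ℕ) :
    dyadicSum (fun n ↦ (Real.log (stern (2 * n + 1)) - c) ^ 2) N k =
      2 ^ N * ((Real.log (stern (2 * k + 1)) + sternMean N (sternRatio k) - c) ^ 2 +
        sternVar N (sternRatio k)) := by
  induction N generalizing k with
  | zero => simp [dyadicSum_zero, sternMean, sternVar]
  | succ N ih =>
    rw [dyadicSum_succ, ih, ih, sternMean, sternVar, sternGap, log_stern_even_child,
      log_stern_odd_child, sternRatio_even, sternRatio_odd]
    ring

theorem integral_exp_logStern (z : ℂ) (N : ℕ) :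
    ∫ n, Complex.exp (z * logStern n) ∂(dyadicUniform N) = sternMgf z N 0 := by
  rw [integral_dyadicUniform]
  unfold logStern
  rw [dyadicSum_stern_one (fun k : ℕ ↦ Complex.exp (z * Real.log k)), dyadicSum_exp_log_stern]
  simp [stern_one, sternRatio_zero]

theorem integral_logStern (N : ℕ) : ∫ n, logStern n ∂(dyadicUniform N) = sternMean N 0 := by
  rw [integral_dyadicUniform]
  unfold logStern
  rw [dyadicSum_stern_one (fun k : ℕ ↦ Real.log k), dyadicSum_log_stern]
  simp [stern_one, sternRatio_zero]

theorem variance_logStern (N : ℕ) : variance logStern (dyadicUniform N) = sternVar N 0 := by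
  rw [variance_eq_integral (integrable_dyadicUniform N _).aemeasurable, integral_logStern,
    integral_dyadicUniform]
  unfold logStern
  rw [dyadicSum_stern_one (fun k : ℕ ↦ (Real.log k - sternMean N 0) ^ 2), dyadicSum_sq_log_stern]
  simp [stern_one, sternRatio_zero]

/-! ### Growth of the mean and of the variance -/

/-- `(1+x)(2-x) = 2 + x(1-x)`. -/
theorem two_le_left_mul_right {x : ℝ} (hx : x ∈ Set.Icc (0 : ℝ) 1) :
    Real.log 2 ≤ Real.log (1 + x) + Real.log (2 - x) := by
  obtain ⟨h0, h1⟩ := hx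
  rw [← Real.log_mul (by linarith) (by linarith)]
  exact Real.log_le_log (by norm_num) (by nlinarith)

theorem sternMean_lower (N : ℕ) {x : ℝ} (hx : x ∈ Set.Icc (0 : ℝ) 1) :
    N * (Real.log 2 / 2) ≤ sternMean N x := by
  induction N generalizing x with
  | zero => simp [sternMean]
  | succ N ih =>
    have h1 := ih (left_mem hx)
    have h2 := ih (right_mem hx)
    have h3 := two_le_left_mul_right hx
    rw [sternMean]
    push_cast
    linarith

/-- The increment in `N` at `x` is the average of the previous increments at the two images of `x`,
so the lower bound for `N = 0` propagates. -/
theorem sternMean_succ_sub (N : ℕ) {x : ℝ} (hx : x ∈ Set.Icc (0 : ℝ) 1) :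
    Real.log 2 / 2 ≤ sternMean (N + 1) x - sternMean N x := by
  induction N generalizing x with
  | zero =>
    simp only [sternMean]
    linarith [two_le_left_mul_right hx]
  | succ N ih =>
    have e (M : ℕ) : sternMean (M + 1) x = (Real.log (1 + x) + sternMean M (x / (1 + x)) +
      (Real.log (2 - x) + sternMean M (1 / (2 - x)))) / 2 := rfl
    rw [e (N + 1), e N]
    linarith [ih (left_mem hx), ih (right_mem hx)]

theorem abs_log_sub_log_le {a b : ℝ} (ha : 1 ≤ a) (hb : 1 ≤ b) :
    |Real.log a - Real.log b| ≤ |a - b| := by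
  wlog h : b ≤ a generalizing a b
  · rw [abs_sub_comm, abs_sub_comm a]
    exact this hb ha (le_of_not_ge h)
  have hb0 : 0 < b := by linarith
  rw [abs_of_nonneg (sub_nonneg.2 (Real.log_le_log hb0 h)), abs_of_nonneg (sub_nonneg.2 h),
    ← Real.log_div (by linarith) (by linarith)]
  refine (Real.log_le_sub_one_of_pos (by positivity)).trans ?_
  rw [div_sub_one hb0.ne']
  exact div_le_self (by linarith) hb

theorem left_sub_left {x y : ℝ} (hx : x ∈ Set.Icc (0 : ℝ) 1) (hy : y ∈ Set.Icc (0 : ℝ) 1) :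
    |x / (1 + x) - y / (1 + y)| = |x - y| * (1 / ((1 + x) * (1 + y))) := by
  have h1 : 0 < 1 + x := by linarith [hx.1]
  have h2 : 0 < 1 + y := by linarith [hy.1]
  have h3 : 0 < 1 / ((1 + x) * (1 + y)) := by positivity
  refine Eq.trans ?_ (congrArg (|x - y| * ·) (abs_of_pos h3))
  rw [← abs_mul]
  congr 1
  field_simp
  ring

theorem right_sub_right {x y : ℝ} (hx : x ∈ Set.Icc (0 : ℝ) 1) (hy : y ∈ Set.Icc (0 : ℝ) 1) :
    |1 / (2 - x) - 1 / (2 - y)| = |x - y| * (1 / ((2 - x) * (2 - y))) := by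
  have h1 : 0 < 2 - x := by linarith [hx.2]
  have h2 : 0 < 2 - y := by linarith [hy.2]
  have h3 : 0 < 1 / ((2 - x) * (2 - y)) := by positivity
  refine Eq.trans ?_ (congrArg (|x - y| * ·) (abs_of_pos h3))
  rw [← abs_mul]
  congr 1
  field_simp
  ring

/-- By convexity `1/(1+x)` and `1/(2-x)` lie below their chords `1-x/2` and `(1+x)/2` on `[0,1]`.
The value 5/4 is attained at `x = y = 0`; what matters is that it is less than 2, since the branches
are averaged. -/
theorem contraction_sum {x y : ℝ} (hx : x ∈ Set.Icc (0 : ℝ) 1) (hy : y ∈ Set.Icc (0 : ℝ) 1) :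
    1 / ((1 + x) * (1 + y)) + 1 / ((2 - x) * (2 - y)) ≤ 5 / 4 := by
  obtain ⟨hx0, hx1⟩ := hx
  obtain ⟨hy0, hy1⟩ := hy
  have h1 : 0 < 1 + x := by linarith
  have h2 : 0 < 1 + y := by linarith
  have h3 : 0 < 2 - x := by linarith
  have h4 : 0 < 2 - y := by linarith
  have e1 : 1 / ((1 + x) * (1 + y)) ≤ (1 - x / 2) * (1 - y / 2) := by
    rw [div_le_iff₀ (by positivity)]
    have : 1 ≤ (1 - x / 2) * (1 + x) := by nlinarith
    have : 1 ≤ (1 - y / 2) * (1 + y) := by nlinarith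
    nlinarith
  have e2 : 1 / ((2 - x) * (2 - y)) ≤ ((1 + x) / 2) * ((1 + y) / 2) := by
    rw [div_le_iff₀ (by positivity)]
    have : 1 ≤ ((1 + x) / 2) * (2 - x) := by nlinarith
    have : 1 ≤ ((1 + y) / 2) * (2 - y) := by nlinarith
    nlinarith
  nlinarith [mul_nonneg hx0 hy0, mul_nonneg (sub_nonneg.2 hx1) (sub_nonneg.2 hy1)]

/-- The logarithms contribute at most 1 after averaging and the branches contract by 5/8, so any `L`
with `1 + 5L/8 ≤ L` is preserved; 3 is such an `L`. -/
theorem sternMean_lipschitz (N : ℕ) {x y : ℝ} (hx : x ∈ Set.Icc (0 : ℝ) 1)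
    (hy : y ∈ Set.Icc (0 : ℝ) 1) : |sternMean N x - sternMean N y| ≤ 3 * |x - y| := by
  induction N generalizing x y with
  | zero => simp [sternMean]
  | succ N ih =>
    have h1 := ih (left_mem hx) (left_mem hy)
    have h2 := ih (right_mem hx) (right_mem hy)
    rw [left_sub_left hx hy] at h1
    rw [right_sub_right hx hy] at h2
    have h3 := abs_log_sub_log_le (a := 1 + x) (b := 1 + y) (by linarith [hx.1]) (by linarith [hy.1])
    have h4 := abs_log_sub_log_le (a := 2 - x) (b := 2 - y) (by linarith [hx.2]) (by linarith [hy.2])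
    rw [show 1 + x - (1 + y) = x - y by ring] at h3
    rw [show 2 - x - (2 - y) = y - x by ring, abs_sub_comm y] at h4
    have h5 := mul_le_mul_of_nonneg_left (contraction_sum hx hy) (abs_nonneg (x - y))
    rw [sternMean, sternMean]
    rw [abs_le] at *
    constructor <;> linarith

/-- The state 0 is fixed by the digit 0, with norm ratio 1. Hence the conditional mean after the
digit 0 is `sternMean N 0`, and the average of the two conditional means exceeds it by at least
`(log 2)/2`; the gap is twice that difference. -/
theorem sternGap_zero_le (N : ℕ) : sternGap N 0 ≤ -Real.log 2 := by
  have h := sternMean_succ_sub N (x := 0) (by simp)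
  rw [sternMean] at h
  rw [sternGap]
  simp only [add_zero, sub_zero, Real.log_one, zero_div] at h ⊢
  linarith

/-- Perturbation of the bound at 0: the logarithms cost `2x` and the means at most `3 · 5/4 · x`,
together below `8x`. -/
theorem sternGap_le (N : ℕ) {x : ℝ} (hx : x ∈ Set.Icc (0 : ℝ) 1) :
    sternGap N x ≤ -Real.log 2 + 8 * x := by
  have h0 : (0 : ℝ) ∈ Set.Icc (0 : ℝ) 1 := by simp
  have h1 := sternMean_lipschitz N (left_mem hx) (left_mem h0)
  have h2 := sternMean_lipschitz N (right_mem hx) (right_mem h0)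
  have h3 := abs_log_sub_log_le (a := 1 + x) (b := 1 + 0) (by linarith [hx.1]) (by linarith)
  have h4 := abs_log_sub_log_le (a := 2 - x) (b := 2 - 0) (by linarith [hx.2]) (by linarith)
  rw [left_sub_left hx h0, sub_zero, abs_of_nonneg hx.1] at h1
  rw [right_sub_right hx h0, sub_zero x, abs_of_nonneg hx.1] at h2
  rw [show 1 + x - (1 + 0) = x by ring, abs_of_nonneg hx.1] at h3
  rw [show 2 - x - (2 - 0) = -x by ring, abs_neg, abs_of_nonneg hx.1] at h4
  have h5 := mul_le_mul_of_nonneg_left (contraction_sum hx h0) hx.1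
  have h6 := sternGap_zero_le N
  simp only [sternGap] at h6 ⊢
  rw [abs_le] at h1 h2 h3 h4
  rw [mul_add] at h5
  generalize x * (1 / ((1 + x) * (1 + 0))) = p at *
  generalize x * (1 / ((2 - x) * (2 - 0))) = q at *
  have hx0 : 0 ≤ x := hx.1
  have a1 := h1.2
  have a2 := h2.1
  have a3 := h3.2
  have a4 := h4.1
  generalize sternMean N (1 / (2 - 0)) = e1 at *
  generalize sternMean N (1 / (2 - x)) = e2 at *
  generalize sternMean N (x / (1 + x)) = e3 at *
  generalize sternMean N (0 / (1 + 0)) = e4 at *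
  generalize Real.log (1 + x) = e5 at *
  generalize Real.log (1 + 0) = e6 at *
  generalize Real.log (2 - x) = e7 at *
  generalize Real.log (2 - 0) = e8 at *
  generalize Real.log 2 = e9 at *
  clear h1 h2 h3 h4 hx h0
  linarith

/-- For `x ≤ 1/20` the gap is at most `-log 2 + 2/5 < 0`, and a quarter of its square exceeds 1/60.
-/
theorem sternVar_step (N : ℕ) {x : ℝ} (hx : x ∈ Set.Icc (0 : ℝ) (1 / 20)) :
    (sternVar N (x / (1 + x)) + sternVar N (1 / (2 - x))) / 2 + 1 / 60 ≤ sternVar (N + 1) x := by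
  have h := sternGap_le N (x := x) ⟨hx.1, hx.2.trans (by norm_num)⟩
  have h2 := Real.log_two_gt_d9
  rw [sternVar]
  nlinarith [hx.2]

theorem sternVar_add_lower {N : ℕ} {v : ℝ} (hv : ∀ x ∈ Set.Icc (0 : ℝ) 1, v ≤ sternVar N x) (j : ℕ) :
    ∀ x ∈ Set.Icc (0 : ℝ) 1, v ≤ sternVar (N + j) x := by
  induction j with
  | zero => exact hv
  | succ j ih =>
    intro x hx
    rw [← add_assoc, sternVar]
    nlinarith [ih _ (left_mem hx), ih _ (right_mem hx), sq_nonneg (sternGap (N + j) x)]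

/-- The branch `x/(1+x)` maps `[0, 1/m]` into `[0, 1/(m+1)]`, so `j` zeros, of probability `2^(-j)`,
lead from `[0, 1/(20-j)]` into `[0, 1/20]`, where the next step gains 1/60. For `j = 19` the
interval is all of `[0,1]`. -/
theorem sternVar_add_lower_near_zero {N : ℕ} {v : ℝ}
    (hv : ∀ x ∈ Set.Icc (0 : ℝ) 1, v ≤ sternVar N x) {j : ℕ} (hj : j < 20) :
    ∀ x ∈ Set.Icc (0 : ℝ) (1 / (20 - j)), v + 1 / 60 / 2 ^ j ≤ sternVar (N + 1 + j) x := by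
  induction j with
  | zero =>
    intro x hx
    simp only [CharP.cast_eq_zero, sub_zero] at hx
    have hx' : x ∈ Set.Icc (0 : ℝ) 1 := ⟨hx.1, hx.2.trans (by norm_num)⟩
    have := sternVar_step N hx
    have h1 := hv _ (left_mem hx')
    have h2 := hv _ (right_mem hx')
    simp only [pow_zero, div_one, add_zero]
    linarith
  | succ j ih =>
    intro x hx
    have hj' : (j : ℝ) + 2 ≤ 20 := by exact_mod_cast hj
    have hpos : (0 : ℝ) < 20 - (j + 1) := by linarith
    push_cast at hx
    have hx' : x ∈ Set.Icc (0 : ℝ) 1 :=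
      ⟨hx.1, hx.2.trans (by rw [div_le_one hpos]; linarith)⟩
    have h1 := ih (by omega) (x / (1 + x)) ⟨(left_mem hx').1, by
      have hx2 := hx.2
      rw [le_div_iff₀ hpos] at hx2
      rw [div_le_div_iff₀ (by linarith [hx.1]) (by linarith)]
      nlinarith [hx.1]⟩
    have h2 := sternVar_add_lower hv (1 + j) _ (right_mem hx')
    rw [← add_assoc] at h2
    rw [← add_assoc, sternVar, pow_succ, ← div_div]
    nlinarith [sq_nonneg (sternGap (N + 1 + j) x)]

theorem sternVar_linear_lower (k : ℕ) :
    ∀ x ∈ Set.Icc (0 : ℝ) 1, k * (1 / 60 / 2 ^ 19) ≤ sternVar (20 * k) x := by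
  induction k with
  | zero => simp [sternVar]
  | succ k ih =>
    intro x hx
    have := sternVar_add_lower_near_zero ih (j := 19) (by norm_num) x ⟨hx.1, by norm_num; exact hx.2⟩
    rw [show 20 * (k + 1) = 20 * k + 1 + 19 by ring]
    push_cast
    linarith

/-! ### Quasi-powers for the transfer operator -/

/-- `f` is `L`-Lipschitz on the unit interval. -/
def LipschitzUnit (L : ℝ) (f : ℝ → ℂ) : Prop :=
  ∀ x ∈ Set.Icc (0 : ℝ) 1, ∀ y ∈ Set.Icc (0 : ℝ) 1, ‖f x - f y‖ ≤ L * |x - y|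

theorem LipschitzUnit.norm_sub_zero_le {L : ℝ} {f : ℝ → ℂ} (hf : LipschitzUnit L f) {x : ℝ}
    (hx : x ∈ Set.Icc (0 : ℝ) 1) : ‖f x - f 0‖ ≤ L * x := by
  simpa [abs_of_nonneg hx.1] using hf x hx 0 (by simp)

theorem LipschitzUnit.nonneg {L : ℝ} {f : ℝ → ℂ} (hf : LipschitzUnit L f) : 0 ≤ L := by
  simpa using (norm_nonneg _).trans (hf.norm_sub_zero_le (x := 1) (by simp))

theorem LipschitzUnit.add {L M : ℝ} {f g : ℝ → ℂ} (hf : LipschitzUnit L f)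
    (hg : LipschitzUnit M g) : LipschitzUnit (L + M) (fun x ↦ f x + g x) := by
  intro x hx y hy
  rw [add_sub_add_comm, add_mul]
  exact (norm_add_le _ _).trans (add_le_add (hf x hx y hy) (hg x hx y hy))

theorem LipschitzUnit.mul_const {L : ℝ} {f : ℝ → ℂ} (hf : LipschitzUnit L f) (c : ℂ) :
    LipschitzUnit (L * ‖c‖) (fun x ↦ f x * c) := by
  intro x hx y hy
  rw [← sub_mul, norm_mul, mul_right_comm]
  exact mul_le_mul_of_nonneg_right (hf x hx y hy) (norm_nonneg _)

theorem LipschitzUnit.mono {L M : ℝ} {f : ℝ → ℂ} (hf : LipschitzUnit L f) (h : L ≤ M) :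
    LipschitzUnit M f := fun x hx y hy ↦
  (hf x hx y hy).trans (mul_le_mul_of_nonneg_right h (abs_nonneg _))

theorem norm_exp_mul_log_sub_one_le {z : ℂ} (hz : ‖z‖ ≤ 1 / 100) {a : ℝ} (ha : 1 ≤ a)
    (ha' : a ≤ 2) : ‖Complex.exp (z * Real.log a) - 1‖ ≤ 1 / 50 := by
  have h1 : |Real.log a| ≤ 1 := by
    rw [abs_of_nonneg (Real.log_nonneg ha)]
    linarith [Real.log_le_sub_one_of_pos (show 0 < a by linarith)]
  have h2 : ‖z * Real.log a‖ ≤ 1 / 100 := by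
    rw [norm_mul, Complex.norm_real, Real.norm_eq_abs]
    nlinarith [norm_nonneg z, abs_nonneg (Real.log a)]
  linarith [Complex.norm_exp_sub_one_le (h2.trans (by norm_num))]

theorem norm_exp_mul_log_le {z : ℂ} (hz : ‖z‖ ≤ 1 / 100) {a : ℝ} (ha : 1 ≤ a) (ha' : a ≤ 2) :
    ‖Complex.exp (z * Real.log a)‖ ≤ 51 / 50 := by
  have h := norm_add_le (Complex.exp (z * Real.log a) - 1) 1
  rw [sub_add_cancel, norm_one] at h
  linarith [norm_exp_mul_log_sub_one_le hz ha ha']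

theorem norm_exp_mul_log_sub_le {z : ℂ} (hz : ‖z‖ ≤ 1 / 100) {a b : ℝ} (ha : 1 ≤ a) (ha' : a ≤ 2)
    (hb : 1 ≤ b) (hb' : b ≤ 2) :
    ‖Complex.exp (z * Real.log a) - Complex.exp (z * Real.log b)‖ ≤ 3 / 100 * |a - b| := by
  have e : Complex.exp (z * Real.log a) - Complex.exp (z * Real.log b) =
      Complex.exp (z * Real.log b) * (Complex.exp (z * (Real.log a - Real.log b)) - 1) := by
    rw [mul_sub, ← Complex.exp_add]; ring_nf
  have h1 := abs_log_sub_log_le ha hb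
  have h3 : |a - b| ≤ 1 := by rw [abs_le]; constructor <;> linarith
  have h2 : ‖z * (Real.log a - Real.log b)‖ ≤ 1 / 100 * |a - b| := by
    rw [norm_mul, ← Complex.ofReal_sub, Complex.norm_real, Real.norm_eq_abs]
    exact mul_le_mul hz h1 (abs_nonneg _) (by norm_num)
  have h4 := Complex.norm_exp_sub_one_le (x := z * (Real.log a - Real.log b)) (by linarith)
  rw [e, norm_mul]
  have h5 := norm_exp_mul_log_le hz hb hb'
  calc _ ≤ 51 / 50 * (2 * (1 / 100 * |a - b|)) := by gcongr; linarith
    _ ≤ _ := by linarith [abs_nonneg (a - b)]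

/-- Vanishing at 0 makes the Lipschitz constant control the sup norm as well, hence also the
variation of the exponential weights. The constant is `(51/50 · 5/4 + 2 · 3/100)/2 ≤ 67/100`. -/
theorem sternTransfer_lipschitz {z : ℂ} (hz : ‖z‖ ≤ 1 / 100) {L : ℝ} {f : ℝ → ℂ}
    (hf : LipschitzUnit L f) (hf0 : f 0 = 0) : LipschitzUnit (67 / 100 * L) (sternTransfer z f) := by
  intro x hx y hy
  have hL := hf.nonneg
  have key {a b u v : ℝ} (ha : 1 ≤ a) (ha' : a ≤ 2) (hb : 1 ≤ b) (hb' : b ≤ 2)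
      (hu : u ∈ Set.Icc (0 : ℝ) 1) (hv : v ∈ Set.Icc (0 : ℝ) 1) (hab : |a - b| = |x - y|) :
      ‖Complex.exp (z * Real.log a) * f u - Complex.exp (z * Real.log b) * f v‖ ≤
        51 / 50 * (L * |u - v|) + 3 / 100 * |x - y| * L := by
    have h1 : ‖f v‖ ≤ L := by
      have := hf.norm_sub_zero_le hv
      rw [hf0, sub_zero] at this
      exact this.trans (mul_le_of_le_one_right hL hv.2)
    rw [show Complex.exp (z * Real.log a) * f u - Complex.exp (z * Real.log b) * f v =
      Complex.exp (z * Real.log a) * (f u - f v) +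
        (Complex.exp (z * Real.log a) - Complex.exp (z * Real.log b)) * f v by ring]
    refine (norm_add_le _ _).trans ?_
    rw [norm_mul, norm_mul]
    gcongr
    · exact norm_exp_mul_log_le hz ha ha'
    · exact hf u hu v hv
    · exact hab ▸ norm_exp_mul_log_sub_le hz ha ha' hb hb'
  have h1 := key (a := 1 + x) (b := 1 + y) (by linarith [hx.1]) (by linarith [hx.2])
    (by linarith [hy.1]) (by linarith [hy.2]) (left_mem hx) (left_mem hy) (by congr 1; ring)
  have h2 := key (a := 2 - x) (b := 2 - y) (by linarith [hx.2]) (by linarith [hx.1])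
    (by linarith [hy.2]) (by linarith [hy.1]) (right_mem hx) (right_mem hy)
    (by rw [abs_sub_comm]; congr 1; ring)
  rw [left_sub_left hx hy] at h1
  rw [right_sub_right hx hy] at h2
  have h3 := mul_le_mul_of_nonneg_left (contraction_sum hx hy) (mul_nonneg hL (abs_nonneg (x - y)))
  rw [sternTransfer, sternTransfer, ← sub_div, add_sub_add_comm, norm_div, Complex.norm_two,
    div_le_iff₀ (by norm_num)]
  refine (norm_add_le _ _).trans ((add_le_add h1 h2).trans ?_)
  have h4 := mul_nonneg hL (abs_nonneg (x - y))
  generalize 1 / ((1 + x) * (1 + y)) = p at *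
  generalize 1 / ((2 - x) * (2 - y)) = q at *
  linarith

theorem sternTransfer_one_lipschitz {z : ℂ} (hz : ‖z‖ ≤ 1 / 100) :
    LipschitzUnit (3 / 100) (sternTransfer z 1) := by
  intro x hx y hy
  have h1 := norm_exp_mul_log_sub_le hz (a := 1 + x) (b := 1 + y) (by linarith [hx.1])
    (by linarith [hx.2]) (by linarith [hy.1]) (by linarith [hy.2])
  have h2 := norm_exp_mul_log_sub_le hz (a := 2 - x) (b := 2 - y) (by linarith [hx.2])
    (by linarith [hx.1]) (by linarith [hy.2]) (by linarith [hy.1])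
  rw [show 1 + x - (1 + y) = x - y by ring] at h1
  rw [show 2 - x - (2 - y) = y - x by ring, abs_sub_comm y] at h2
  simp only [sternTransfer, Pi.one_apply, mul_one]
  rw [← sub_div, add_sub_add_comm, norm_div, Complex.norm_two, div_le_iff₀ (by norm_num)]
  refine (norm_add_le _ _).trans ((add_le_add h1 h2).trans ?_)
  linarith

theorem sternTransfer_add (z : ℂ) (f g : ℝ → ℂ) (x : ℝ) :
    sternTransfer z (fun y ↦ f y + g y) x = sternTransfer z f x + sternTransfer z g x := by
  simp only [sternTransfer]; ring

theorem sternTransfer_mul_const (z c : ℂ) (f : ℝ → ℂ) (x : ℝ) :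
    sternTransfer z (fun y ↦ f y * c) x = sternTransfer z f x * c := by
  simp only [sternTransfer]; ring

theorem sternTransfer_apply_zero (z : ℂ) (f : ℝ → ℂ) :
    sternTransfer z f 0 = (f 0 + Complex.exp (z * Real.log 2) * f (1 / 2)) / 2 := by
  simp [sternTransfer]

/-! ### Geometric contraction of the iterates normalized at 0 -/

section Normalized

variable {z : ℂ} (hz : ‖z‖ ≤ 1 / 100) {f g : ℝ → ℂ}

include hz

/-- Split `f = 1 + (f - 1)`: the second summand vanishes at 0, so it is contracted, while the first
contributes only through the small variation of the weights. -/
theorem sternTransfer_lipschitz_of_near_one (hf : LipschitzUnit (1 / 5) f) (hf0 : f 0 = 1) :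
    LipschitzUnit (41 / 250) (sternTransfer z f) := by
  have h := (sternTransfer_one_lipschitz hz).add (sternTransfer_lipschitz hz (L := 1 / 5)
    (f := fun x ↦ f x + -1) (fun x hx y hy ↦ by simpa using hf x hx y hy) (by simp [hf0]))
  refine LipschitzUnit.mono (fun x hx y hy ↦ ?_) (show 3 / 100 + 67 / 100 * (1 / 5) ≤ _ by norm_num)
  have := h x hx y hy
  simp only [← sternTransfer_add] at this
  simpa using this

theorem norm_sternTransfer_zero_sub_one_le (hf : LipschitzUnit (1 / 5) f) (hf0 : f 0 = 1) :
    ‖sternTransfer z f 0 - 1‖ ≤ 7 / 100 := by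
  have h1 := norm_exp_mul_log_sub_one_le hz (a := 2) (by norm_num) le_rfl
  have h2 := hf.norm_sub_zero_le (x := 1 / 2) (by norm_num)
  have h3 := norm_exp_mul_log_le hz (a := 2) (by norm_num) le_rfl
  rw [hf0] at h2
  rw [sternTransfer_apply_zero, hf0, show (1 + Complex.exp (z * Real.log 2) * f (1 / 2)) / 2 - 1 =
    (Complex.exp (z * Real.log 2) * (f (1 / 2) - 1) + (Complex.exp (z * Real.log 2) - 1)) / 2 by ring,
    norm_div, Complex.norm_two, div_le_iff₀ (by norm_num)]
  refine (norm_add_le _ _).trans ?_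
  rw [norm_mul]
  nlinarith [norm_nonneg (Complex.exp (z * Real.log 2)), norm_nonneg (f (1 / 2) - 1)]

theorem norm_sternTransfer_zero_sub_le {D : ℝ} (hf0 : f 0 = 1) (hg0 : g 0 = 1)
    (hfg : LipschitzUnit D (fun x ↦ f x - g x)) :
    ‖sternTransfer z f 0 - sternTransfer z g 0‖ ≤ 51 / 200 * D := by
  have h2 := hfg.norm_sub_zero_le (x := 1 / 2) (by norm_num)
  have h3 := norm_exp_mul_log_le hz (a := 2) (by norm_num) le_rfl
  have hD := hfg.nonneg
  rw [hf0, hg0, sub_self, sub_zero] at h2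
  rw [sternTransfer_apply_zero, sternTransfer_apply_zero, hf0, hg0, ← sub_div, add_sub_add_left_eq_sub,
    ← mul_sub, norm_div, Complex.norm_two, div_le_iff₀ (by norm_num), norm_mul]
  calc _ ≤ 51 / 50 * (D * (1 / 2)) := by gcongr
    _ = _ := by ring

theorem norm_inv_sternTransfer_zero_le (hf : LipschitzUnit (1 / 5) f) (hf0 : f 0 = 1) :
    sternTransfer z f 0 ≠ 0 ∧ ‖(sternTransfer z f 0)⁻¹‖ ≤ 100 / 93 := by
  have h := norm_sternTransfer_zero_sub_one_le hz hf hf0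
  have h1 := norm_sub_norm_le (1 : ℂ) (1 - sternTransfer z f 0)
  rw [sub_sub_cancel, norm_one, norm_sub_rev] at h1
  have h2 : 93 / 100 ≤ ‖sternTransfer z f 0‖ := by linarith
  refine ⟨norm_pos_iff.1 (by linarith), ?_⟩
  rw [norm_inv, inv_le_comm₀ (by linarith) (by norm_num)]
  norm_num at h2 ⊢
  exact h2

theorem normalized_lipschitz (hf : LipschitzUnit (1 / 5) f) (hf0 : f 0 = 1) :
    LipschitzUnit (1 / 5) (fun x ↦ sternTransfer z f x * (sternTransfer z f 0)⁻¹) := by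
  refine ((sternTransfer_lipschitz_of_near_one hz hf hf0).mul_const _).mono ?_
  linarith [(norm_inv_sternTransfer_zero_le hz hf hf0).2]

/-- The difference splits into the image of `f - g`, contracted by `67/100 · 100/93`, and the effect
of the two different normalizing factors, at most `41/250 · 51/200 · (100/93)²`. The sum is below
4/5. -/
theorem normalized_contraction (hf : LipschitzUnit (1 / 5) f) (hf0 : f 0 = 1)
    (hg : LipschitzUnit (1 / 5) g) (hg0 : g 0 = 1) {D : ℝ}
    (hfg : LipschitzUnit D (fun x ↦ f x - g x)) :
    LipschitzUnit (4 / 5 * D) (fun x ↦ sternTransfer z f x * (sternTransfer z f 0)⁻¹ -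
      sternTransfer z g x * (sternTransfer z g 0)⁻¹) := by
  have hD := hfg.nonneg
  obtain ⟨hcf, hcf'⟩ := norm_inv_sternTransfer_zero_le hz hf hf0
  obtain ⟨hcg, hcg'⟩ := norm_inv_sternTransfer_zero_le hz hg hg0
  have h0 := norm_sternTransfer_zero_sub_le hz hf0 hg0 hfg
  have h1 := (sternTransfer_lipschitz hz hfg (by simp [hf0, hg0])).mul_const (sternTransfer z f 0)⁻¹
  have h2 := (sternTransfer_lipschitz_of_near_one hz hg hg0).mul_const
    ((sternTransfer z f 0)⁻¹ - (sternTransfer z g 0)⁻¹)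
  have h3 : ‖(sternTransfer z f 0)⁻¹ - (sternTransfer z g 0)⁻¹‖ ≤
      51 / 200 * D * (100 / 93) * (100 / 93) := by
    rw [inv_sub_inv' hcf hcg, norm_mul, norm_mul, norm_sub_rev]
    calc _ ≤ 100 / 93 * (51 / 200 * D) * (100 / 93) := by gcongr
      _ = _ := by ring
  have h4 := (h1.add h2).mono (M := 4 / 5 * D) (by
    have := mul_le_mul_of_nonneg_left hcf' hD
    nlinarith)
  have e (x : ℝ) : sternTransfer z (fun x ↦ f x - g x) x = sternTransfer z f x - sternTransfer z g x := by
    simp only [sternTransfer]; ring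
  convert h4 using 2 with x
  rw [e]
  ring

/-- The iterates of the transfer operator on `1`, normalized at `0`. -/
theorem normalized_mgf (N : ℕ) : sternMgf z N 0 ≠ 0 ∧
    LipschitzUnit (1 / 5) (fun x ↦ sternMgf z N x * (sternMgf z N 0)⁻¹) ∧
    LipschitzUnit (2 / 5 * (4 / 5) ^ N) (fun x ↦ sternMgf z (N + 1) x * (sternMgf z (N + 1) 0)⁻¹ -
      sternMgf z N x * (sternMgf z N 0)⁻¹) := by
  have succ (M : ℕ) (h : sternMgf z M 0 ≠ 0) (x : ℝ) :
      sternTransfer z (fun x ↦ sternMgf z M x * (sternMgf z M 0)⁻¹) x =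
        sternMgf z (M + 1) x * (sternMgf z M 0)⁻¹ := by
    rw [sternTransfer_mul_const, sternMgf_succ]
  -- By linearity, scalar factors cancel in the normalized step, so it sends each normalized iterate
  -- to the next one.
  have succ' (M : ℕ) (h : sternMgf z M 0 ≠ 0) (x : ℝ) :
      sternTransfer z (fun x ↦ sternMgf z M x * (sternMgf z M 0)⁻¹) x *
        (sternTransfer z (fun x ↦ sternMgf z M x * (sternMgf z M 0)⁻¹) 0)⁻¹ =
        sternMgf z (M + 1) x * (sternMgf z (M + 1) 0)⁻¹ := by
    rw [succ M h, succ M h, mul_inv_rev, inv_inv]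
    field_simp
  have step (M : ℕ) (h : sternMgf z M 0 ≠ 0)
      (hl : LipschitzUnit (1 / 5) (fun x ↦ sternMgf z M x * (sternMgf z M 0)⁻¹)) :
      sternMgf z (M + 1) 0 ≠ 0 ∧
        LipschitzUnit (1 / 5) (fun x ↦ sternMgf z (M + 1) x * (sternMgf z (M + 1) 0)⁻¹) := by
    constructor
    · have := (norm_inv_sternTransfer_zero_le hz hl (mul_inv_cancel₀ h)).1
      rw [succ M h] at this
      exact left_ne_zero_of_mul this
    · have := normalized_lipschitz hz hl (mul_inv_cancel₀ h)
      simpa only [succ' M h] using this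
  induction N with
  | zero =>
    have h0 : LipschitzUnit (1 / 5) (fun x ↦ sternMgf z 0 x * (sternMgf z 0 0)⁻¹) := by
      intro x _ y _
      simp only [sternMgf_zero, sub_self, norm_zero]
      positivity
    have h00 : sternMgf z 0 0 ≠ 0 := by simp [sternMgf_zero]
    refine ⟨h00, h0, ?_⟩
    have h1 := ((step 0 h00 h0).2.add (h0.mul_const (-1))).mono (M := 2 / 5 * (4 / 5) ^ 0)
      (by norm_num)
    simpa only [mul_neg_one, ← sub_eq_add_neg] using h1
  | succ N ih =>
    obtain ⟨h, hl, hd⟩ := ih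
    obtain ⟨h', hl'⟩ := step N h hl
    refine ⟨h', hl', ?_⟩
    have := normalized_contraction hz hl' (mul_inv_cancel₀ h') hl (mul_inv_cancel₀ h) hd
    simp only [succ' N h, succ' _ h'] at this
    refine this.mono (le_of_eq ?_)
    ring

omit hz in
theorem sternTransfer_normalized_zero (N : ℕ) :
    sternTransfer z (fun x ↦ sternMgf z N x * (sternMgf z N 0)⁻¹) 0 =
      sternMgf z (N + 1) 0 / sternMgf z N 0 := by
  rw [sternTransfer_mul_const, sternMgf_succ, div_eq_mul_inv]

theorem norm_mgf_ratio_sub_one_le (N : ℕ) :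
    ‖sternMgf z (N + 1) 0 / sternMgf z N 0 - 1‖ ≤ 7 / 100 := by
  obtain ⟨h, hl, -⟩ := normalized_mgf hz N
  rw [← sternTransfer_normalized_zero]
  exact norm_sternTransfer_zero_sub_one_le hz hl (mul_inv_cancel₀ h)

theorem norm_mgf_ratio_sub_le (N : ℕ) :
    ‖sternMgf z (N + 1 + 1) 0 / sternMgf z (N + 1) 0 - sternMgf z (N + 1) 0 / sternMgf z N 0‖ ≤
      1 / 5 * (4 / 5) ^ N := by
  obtain ⟨h, hl, hd⟩ := normalized_mgf hz N
  obtain ⟨h', hl', -⟩ := normalized_mgf hz (N + 1)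
  rw [← sternTransfer_normalized_zero, ← sternTransfer_normalized_zero]
  refine (norm_sternTransfer_zero_sub_le hz (mul_inv_cancel₀ h') (mul_inv_cancel₀ h) hd).trans ?_
  linarith [pow_pos (show (0 : ℝ) < 4 / 5 by norm_num) N]

end Normalized

/-! ### Holomorphic limits and the quasi-power form -/

theorem differentiable_sternMgf (N : ℕ) (x : ℝ) : Differentiable ℂ (fun z ↦ sternMgf z N x) := by
  induction N generalizing x with
  | zero => simp only [sternMgf_zero]; fun_prop
  | succ N ih =>
    simp only [sternMgf_succ, sternTransfer]
    have h1 := ih (x / (1 + x))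
    have h2 := ih (1 / (2 - x))
    fun_prop

theorem sternMgf_zero_left (N : ℕ) (x : ℝ) : sternMgf 0 N x = 1 := by
  induction N generalizing x with
  | zero => rfl
  | succ N ih => simp [sternMgf_succ, sternTransfer, ih]

theorem norm_log_sub_log_le {a b : ℂ} (ha : ‖a - 1‖ ≤ 1 / 2) (hb : ‖b - 1‖ ≤ 1 / 2) :
    ‖Complex.log a - Complex.log b‖ ≤ 2 * ‖a - b‖ := by
  have hs (x : ℂ) (hx : x ∈ Metric.closedBall (1 : ℂ) (1 / 2)) : x ∈ Complex.slitPlane ∧ 1 / 2 ≤ ‖x‖ := by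
    rw [Metric.mem_closedBall, dist_eq_norm] at hx
    refine ⟨?_, ?_⟩
    · have := (Complex.abs_re_le_norm (x - 1)).trans hx
      rw [abs_le] at this
      left
      simp at this
      linarith
    · have h1 := norm_sub_norm_le (1 : ℂ) (1 - x)
      rw [sub_sub_cancel, norm_one, norm_sub_rev] at h1
      linarith
  refine Convex.norm_image_sub_le_of_norm_deriv_le (𝕜 := ℂ) (s := Metric.closedBall (1 : ℂ) (1 / 2))
    (fun x hx ↦ (Complex.differentiableAt_log (hs x hx).1)) (fun x hx ↦ ?_) (convex_closedBall _ _)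
    (by simpa [dist_eq_norm] using hb) (by simpa [dist_eq_norm] using ha)
  rw [(Complex.hasDerivAt_log (hs x hx).1).deriv, norm_inv]
  exact inv_le_of_inv_le₀ (by norm_num) (by simpa using (hs x hx).2)

/-- A geometrically Cauchy sequence of holomorphic functions converges geometrically to a holomorphic
function. -/
theorem exists_limit_of_geometric {U : Set ℂ} (hU : IsOpen U) {F : ℕ → ℂ → ℂ}
    (hF : ∀ N, DifferentiableOn ℂ (F N) U) {C θ : ℝ} (hθ0 : 0 ≤ θ) (hθ : θ < 1)
    (h : ∀ N, ∀ z ∈ U, ‖F (N + 1) z - F N z‖ ≤ C * θ ^ N) :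
    ∃ G : ℂ → ℂ, DifferentiableOn ℂ G U ∧ ∀ N, ∀ z ∈ U, ‖F N z - G z‖ ≤ C / (1 - θ) * θ ^ N := by
  have hd (z : ℂ) (hz : z ∈ U) (N : ℕ) : dist (F N z) (F (N + 1) z) ≤ C * θ ^ N := by
    rw [dist_comm, dist_eq_norm]; exact h N z hz
  have hex (z : ℂ) : ∃ w, z ∈ U → Filter.Tendsto (fun N ↦ F N z) Filter.atTop (nhds w) := by
    by_cases hz : z ∈ U
    · obtain ⟨w, hw⟩ := cauchySeq_tendsto_of_complete (cauchySeq_of_le_geometric θ C hθ (hd z hz))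
      exact ⟨w, fun _ ↦ hw⟩
    · exact ⟨0, fun h ↦ absurd h hz⟩
  choose G hG using hex
  have hb (N : ℕ) (z : ℂ) (hz : z ∈ U) : ‖F N z - G z‖ ≤ C / (1 - θ) * θ ^ N := by
    rw [← dist_eq_norm]
    refine (dist_le_of_le_geometric_of_tendsto θ C hθ (hd z hz) (hG z hz) N).trans (le_of_eq ?_)
    ring
  refine ⟨G, ?_, hb⟩
  refine TendstoLocallyUniformlyOn.differentiableOn (φ := Filter.atTop) (F := F) ?_
    (Filter.Eventually.of_forall hF) hU
  refine TendstoUniformlyOn.tendstoLocallyUniformlyOn ?_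
  rw [Metric.tendstoUniformlyOn_iff]
  intro ε hε
  have ht : Filter.Tendsto (fun N : ℕ ↦ C / (1 - θ) * θ ^ N) Filter.atTop (nhds 0) := by
    simpa using (tendsto_pow_atTop_nhds_zero_of_lt_one hθ0 hθ).const_mul (C / (1 - θ))
  filter_upwards [ht.eventually (gt_mem_nhds hε)] with N hN z hz
  rw [dist_comm, dist_eq_norm]
  exact (hb N z hz).trans_lt hN

/-- The logarithms of the successive ratios of `sternMgf z N 0` converge geometrically to `Λ`, and
`R N` is the sum of the first `N` deviations from `Λ`, a geometrically convergent series. The ratios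
stay within 7/100 of 1, so the principal logarithm is holomorphic along them. -/
theorem sternMgf_quasi_power : ∃ (Λ H : ℂ → ℂ) (R : ℕ → ℂ → ℂ) (C : ℝ),
    DifferentiableOn ℂ Λ (Metric.ball 0 (1 / 100)) ∧ DifferentiableOn ℂ H (Metric.ball 0 (1 / 100)) ∧
    (∀ N, DifferentiableOn ℂ (R N) (Metric.ball 0 (1 / 100))) ∧ Λ 0 = 0 ∧ (∀ N, R N 0 = 0) ∧
    (∀ N, ∀ z ∈ Metric.ball (0 : ℂ) (1 / 100), ‖R N z - H z‖ ≤ C * (4 / 5) ^ N) ∧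
    (∀ N, ∀ z ∈ Metric.ball (0 : ℂ) (1 / 100), sternMgf z N 0 = Complex.exp (N * Λ z + R N z)) := by
  have hU : IsOpen (Metric.ball (0 : ℂ) (1 / 100)) := Metric.isOpen_ball
  have hz' {z : ℂ} (hz : z ∈ Metric.ball (0 : ℂ) (1 / 100)) : ‖z‖ ≤ 1 / 100 := by
    simpa using (Metric.mem_ball.1 hz).le
  set ℓ : ℕ → ℂ → ℂ := fun N z ↦ Complex.log (sternMgf z (N + 1) 0 / sternMgf z N 0) with hℓ
  have hdiff (N : ℕ) : DifferentiableOn ℂ (ℓ N) (Metric.ball 0 (1 / 100)) := by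
    refine DifferentiableOn.clog ?_ fun z hz ↦ ?_
    · exact (differentiable_sternMgf _ _).differentiableOn.div
        (differentiable_sternMgf _ _).differentiableOn fun z hz ↦ (normalized_mgf (hz' hz) N).1
    · left
      have := (Complex.abs_re_le_norm _).trans (norm_mgf_ratio_sub_one_le (hz' hz) N)
      rw [abs_le, Complex.sub_re, Complex.one_re] at this
      linarith [this.1]
  obtain ⟨Λ, hΛd, hΛ⟩ := exists_limit_of_geometric hU hdiff (C := 2 / 5) (θ := 4 / 5) (by norm_num)
    (by norm_num) fun N z hz ↦ by
      have h1 := norm_log_sub_log_le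
        ((norm_mgf_ratio_sub_one_le (hz' hz) (N + 1)).trans (by norm_num))
        ((norm_mgf_ratio_sub_one_le (hz' hz) N).trans (by norm_num))
      have h2 := norm_mgf_ratio_sub_le (hz' hz) N
      simp only [hℓ]
      linarith
  obtain ⟨H, hHd, hH⟩ := exists_limit_of_geometric hU
    (F := fun N z ↦ ∑ k ∈ Finset.range N, (ℓ k z - Λ z))
    (fun N ↦ DifferentiableOn.fun_sum fun k _ ↦ (hdiff k).sub hΛd) (θ := 4 / 5) (by norm_num)
    (by norm_num) fun N z hz ↦ by
      rw [Finset.sum_range_succ, add_sub_cancel_left]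
      exact hΛ N z hz
  have h0 : (0 : ℂ) ∈ Metric.ball (0 : ℂ) (1 / 100) := by simp
  have hℓ0 (k : ℕ) : ℓ k 0 = 0 := by simp [hℓ, sternMgf_zero_left]
  have hΛ0 : Λ 0 = 0 := by
    have h (N : ℕ) := hΛ N 0 h0
    simp only [hℓ0, zero_sub, norm_neg] at h
    have ht : Filter.Tendsto (fun N : ℕ ↦ (2 / 5 : ℝ) / (1 - 4 / 5) * (4 / 5) ^ N)
        Filter.atTop (nhds 0) := by
      simpa using (tendsto_pow_atTop_nhds_zero_of_lt_one (r := (4 / 5 : ℝ)) (by norm_num)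
        (by norm_num)).const_mul ((2 / 5 : ℝ) / (1 - 4 / 5))
    exact norm_le_zero_iff.1 (ge_of_tendsto' ht h)
  refine ⟨Λ, H, fun N z ↦ ∑ k ∈ Finset.range N, (ℓ k z - Λ z), _, hΛd, hHd,
    fun N ↦ DifferentiableOn.fun_sum fun k _ ↦ (hdiff k).sub hΛd, hΛ0,
    fun N ↦ by simp [hℓ0, hΛ0], hH, fun N z hz ↦ ?_⟩
  -- The product of the ratios telescopes from the initial value 1, so the sum of the `ℓ k z` is a
  -- logarithm of `sternMgf z N 0`.
  have e : N * Λ z + ∑ k ∈ Finset.range N, (ℓ k z - Λ z) = ∑ k ∈ Finset.range N, ℓ k z := by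
    simp [Finset.sum_sub_distrib]
  rw [e, Complex.exp_sum]
  have e2 (k : ℕ) : Complex.exp (ℓ k z) = sternMgf z (k + 1) 0 / sternMgf z k 0 :=
    Complex.exp_log (div_ne_zero (normalized_mgf (hz' hz) _).1 (normalized_mgf (hz' hz) _).1)
  simp only [e2]
  induction N with
  | zero => simp [sternMgf_zero]
  | succ N ih =>
    rw [Finset.prod_range_succ, ← ih (by simp), mul_div_cancel₀ _ (normalized_mgf (hz' hz) _).1]

/-! ### Moments from quasi-powers -/

theorem deriv_of_eq_exp {U : Set ℂ} (hU : IsOpen U) (h0 : (0 : ℂ) ∈ U) {f K : ℂ → ℂ}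
    (hK : DifferentiableOn ℂ K U) (hK0 : K 0 = 0) (hf : ∀ z ∈ U, f z = Complex.exp (K z)) :
    deriv f 0 = deriv K 0 ∧ deriv (deriv f) 0 = deriv (deriv K) 0 + deriv K 0 ^ 2 := by
  have h1 (z : ℂ) (hz : z ∈ U) : deriv f z = Complex.exp (K z) * deriv K z := by
    have he : f =ᶠ[nhds z] fun w ↦ Complex.exp (K w) := by
      filter_upwards [hU.mem_nhds hz] with w hw using hf w hw
    rw [he.deriv_eq]
    exact ((hK.differentiableAt (hU.mem_nhds hz)).hasDerivAt.cexp).deriv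
  refine ⟨by rw [h1 0 h0, hK0]; simp, ?_⟩
  have he : deriv f =ᶠ[nhds 0] fun w ↦ Complex.exp (K w) * deriv K w := by
    filter_upwards [hU.mem_nhds h0] with w hw using h1 w hw
  rw [he.deriv_eq]
  have hK1 := (hK.differentiableAt (hU.mem_nhds h0)).hasDerivAt
  have hK2 := ((hK.deriv hU).differentiableAt (hU.mem_nhds h0)).hasDerivAt
  rw [(hK1.cexp.fun_mul hK2).deriv, hK0]
  simp
  ring

theorem deriv_sternMgf (N : ℕ) :
    deriv (fun z ↦ sternMgf z N 0) 0 = ((∫ n, logStern n ∂(dyadicUniform N) : ℝ) : ℂ) ∧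
    deriv (deriv (fun z ↦ sternMgf z N 0)) 0 =
      ((∫ n, logStern n ^ 2 ∂(dyadicUniform N) : ℝ) : ℂ) := by
  have e : (fun z ↦ sternMgf z N 0) = fun z : ℂ ↦
      (2 ^ N : ℂ)⁻¹ * ∑ n ∈ Finset.Ico (1 * 2 ^ N) ((1 + 1) * 2 ^ N), Complex.exp (z * logStern n) := by
    ext z
    rw [← integral_exp_logStern, integral_dyadicUniform]
    simp [dyadicSum]
  have d1 (c : ℕ → ℂ) (z : ℂ) : HasDerivAt (fun z : ℂ ↦
      (2 ^ N : ℂ)⁻¹ * ∑ n ∈ Finset.Ico (1 * 2 ^ N) ((1 + 1) * 2 ^ N),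
        c n * Complex.exp (z * logStern n))
      ((2 ^ N : ℂ)⁻¹ * ∑ n ∈ Finset.Ico (1 * 2 ^ N) ((1 + 1) * 2 ^ N),
        (c n * logStern n) * Complex.exp (z * logStern n)) z := by
    refine HasDerivAt.const_mul _ (HasDerivAt.fun_sum fun n _ ↦ ?_)
    have := (((hasDerivAt_id z).mul_const (logStern n : ℂ)).cexp).const_mul (c n)
    exact this.congr_deriv (by simp only [id]; ring)
  have e1 : deriv (fun z ↦ sternMgf z N 0) = fun z : ℂ ↦
      (2 ^ N : ℂ)⁻¹ * ∑ n ∈ Finset.Ico (1 * 2 ^ N) ((1 + 1) * 2 ^ N),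
        (1 * logStern n) * Complex.exp (z * logStern n) := by
    ext z
    rw [e, ← (d1 (fun _ ↦ 1) z).deriv]
    simp
  constructor
  · rw [e1, integral_dyadicUniform]
    simp [dyadicSum]
  · rw [e1, (d1 _ 0).deriv, integral_dyadicUniform]
    simp [dyadicSum, sq]

/-- Cauchy's estimates on the circle of radius `r/2`. -/
theorem norm_deriv_le_of_ball {f : ℂ → ℂ} {r M : ℝ} (hr : 0 < r) {w : ℂ}
    (hf : DifferentiableOn ℂ f (Metric.ball w r)) (hM : ∀ z ∈ Metric.ball w r, ‖f z‖ ≤ M) :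
    ‖deriv f w‖ ≤ 2 * M / r ∧ ‖deriv (deriv f) w‖ ≤ 8 * M / r ^ 2 := by
  have hs : Metric.closedBall w (r / 2) ⊆ Metric.ball w r :=
    Metric.closedBall_subset_ball (by linarith)
  have hd : DiffContOnCl ℂ f (Metric.ball w (r / 2)) := (hf.mono hs).diffContOnCl_ball subset_rfl
  have hb : ∀ z ∈ Metric.sphere w (r / 2), ‖f z‖ ≤ M :=
    fun z hz ↦ hM z (hs (Metric.sphere_subset_closedBall hz))
  have h1 := Complex.norm_iteratedDeriv_le_of_forall_mem_sphere_norm_le 1 (by linarith) hd hb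
  have h2 := Complex.norm_iteratedDeriv_le_of_forall_mem_sphere_norm_le 2 (by linarith) hd hb
  rw [iteratedDeriv_one] at h1
  rw [iteratedDeriv_succ, iteratedDeriv_one] at h2
  refine ⟨h1.trans (le_of_eq ?_), h2.trans (le_of_eq ?_)⟩
  · simp; field_simp
  · simp [Nat.factorial]; field_simp; ring

theorem le_of_forall_nat_mul_le {a b c : ℝ} (h : ∀ N : ℕ, c * N ≤ a * N + b) : c ≤ a := by
  by_contra! hlt
  obtain ⟨N, hN⟩ := exists_nat_gt (b / (c - a))
  rw [div_lt_iff₀ (by linarith)] at hN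
  linarith [h N]

/-- The imaginary part of `N a + b` is bounded in `N` because `e N` is real, which forces `a` to be
real. -/
theorem real_of_affine_approx {e : ℕ → ℝ} {a b : ℂ} {C θ : ℝ} (hC : 0 ≤ C) (hθ0 : 0 ≤ θ) (hθ : θ ≤ 1)
    (h : ∀ N : ℕ, ‖(e N : ℂ) - (N * a + b)‖ ≤ C * θ ^ N) :
    a.im = 0 ∧ ∀ N : ℕ, |e N - (a.re * N + b.re)| ≤ C * θ ^ N := by
  constructor
  · have him (N : ℕ) : |N * a.im + b.im| ≤ C := by
      have := (Complex.abs_im_le_norm _).trans ((h N).trans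
        (mul_le_of_le_one_right hC (pow_le_one₀ hθ0 hθ)))
      rw [← abs_neg]
      simpa [add_comm] using this
    have h1 : (0 : ℝ) ≤ a.im := le_of_forall_nat_mul_le (b := C + b.im) fun N ↦ by
      linarith [neg_abs_le (N * a.im + b.im), him N]
    have h2 : a.im ≤ (0 : ℝ) := le_of_forall_nat_mul_le (b := C - b.im) fun N ↦ by
      linarith [le_abs_self (N * a.im + b.im), him N]
    linarith
  · intro N
    have := (Complex.abs_re_le_norm _).trans (h N)
    simpa [mul_comm] using this

theorem logStern_ae_bounded (N : ℕ) : ∃ B, ∀ᵐ n ∂(dyadicUniform N), |logStern n| ≤ B := by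
  refine ⟨∑ n ∈ Finset.range (2 ^ (N + 1)), |logStern n|, ?_⟩
  have : ∀ᵐ n ∂(dyadicUniform N), n ∈ Set.Ico (2 ^ N) (2 ^ (N + 1)) := by
    rw [dyadicUniform, uniformOn]
    exact ae_cond_mem measurableSet_Ico
  filter_upwards [this] with n hn
  exact Finset.single_le_sum (f := fun n ↦ |logStern n|) (fun _ _ ↦ abs_nonneg _)
    (Finset.mem_range.2 hn.2)

/-- The cumulant structure of `log s(n)`: quasi-powers, with the asymptotics of mean and variance. -/
theorem logStern_quasi_power : ∃ (α σ ν₁ ν₂ C : ℝ) (Λ : ℂ → ℂ) (R : ℕ → ℂ → ℂ), 0 < α ∧ 0 < σ ∧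
    (∀ N : ℕ, |(∫ n, logStern n ∂(dyadicUniform N)) - (α * N + ν₁)| ≤ C * (4 / 5) ^ N) ∧
    (∀ N : ℕ, |variance logStern (dyadicUniform N) - (σ ^ 2 * N + ν₂)| ≤ C * (4 / 5) ^ N) ∧
    DifferentiableOn ℂ Λ (Metric.ball 0 (1 / 200)) ∧
    Λ 0 = 0 ∧ deriv Λ 0 = α ∧ deriv (deriv Λ) 0 = (σ : ℂ) ^ 2 ∧
    (∀ N, DifferentiableOn ℂ (R N) (Metric.ball 0 (1 / 200))) ∧ (∀ N, R N 0 = 0) ∧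
    (∀ N, ∀ z ∈ Metric.ball (0 : ℂ) (1 / 200), ‖R N z‖ ≤ C) ∧
    (∀ N, ∀ z ∈ Metric.ball (0 : ℂ) (1 / 200),
      ∫ n, Complex.exp (z * logStern n) ∂(dyadicUniform N) = Complex.exp (N * Λ z + R N z)) := by
  obtain ⟨Λ, H, R, C, hΛ, hH, hR, hΛ0, hR0, hRH, hM⟩ := sternMgf_quasi_power
  set U := Metric.ball (0 : ℂ) (1 / 100) with hUdef
  have hU : IsOpen U := Metric.isOpen_ball
  have h0 : (0 : ℂ) ∈ U := by simp [hUdef]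
  have hUn : U ∈ nhds (0 : ℂ) := hU.mem_nhds h0
  have hC : 0 ≤ C := by simpa using (norm_nonneg _).trans (hRH 0 0 h0)
  -- Halving the radius puts the domain inside a compact subset of `U`, on which the limit `H` is
  -- bounded.
  have hsub : Metric.closedBall (0 : ℂ) (1 / 200) ⊆ U := Metric.closedBall_subset_ball (by norm_num)
  have hdd {f : ℂ → ℂ} (hf : DifferentiableOn ℂ f U) :
      DifferentiableAt ℂ f 0 ∧ DifferentiableAt ℂ (deriv f) 0 :=
    ⟨hf.differentiableAt hUn, (hf.deriv hU).differentiableAt hUn⟩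
  have hderiv (N : ℕ) : deriv (fun z ↦ N * Λ z + R N z) 0 = N * deriv Λ 0 + deriv (R N) 0 ∧
      deriv (deriv (fun z ↦ N * Λ z + R N z)) 0 =
        N * deriv (deriv Λ) 0 + deriv (deriv (R N)) 0 := by
    have h1 (z : ℂ) (hz : z ∈ U) :
        deriv (fun z ↦ N * Λ z + R N z) z = N * deriv Λ z + deriv (R N) z :=
      (((hΛ.differentiableAt (hU.mem_nhds hz)).hasDerivAt.const_mul (N : ℂ)).add
        ((hR N).differentiableAt (hU.mem_nhds hz)).hasDerivAt).deriv
    refine ⟨h1 0 h0, ?_⟩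
    have he : deriv (fun z ↦ N * Λ z + R N z) =ᶠ[nhds 0] fun z ↦ N * deriv Λ z + deriv (R N) z := by
      filter_upwards [hUn] with z hz using h1 z hz
    rw [he.deriv_eq]
    exact (((hdd hΛ).2.hasDerivAt.const_mul (N : ℂ)).add (hdd (hR N)).2.hasDerivAt).deriv
  have hcum (N : ℕ) : (((∫ n, logStern n ∂(dyadicUniform N) : ℝ) : ℂ) =
        N * deriv Λ 0 + deriv (R N) 0) ∧
      ((variance logStern (dyadicUniform N) : ℝ) : ℂ) =
        N * deriv (deriv Λ) 0 + deriv (deriv (R N)) 0 := by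
    obtain ⟨h1, h2⟩ := deriv_of_eq_exp hU h0 (K := fun z ↦ N * Λ z + R N z)
      ((hΛ.const_mul _).add (hR N)) (by simp [hΛ0, hR0]) (hM N)
    obtain ⟨h3, h4⟩ := deriv_sternMgf N
    rw [h3, (hderiv N).1] at h1
    rw [h4, (hderiv N).2, (hderiv N).1, ← h1] at h2
    refine ⟨h1, ?_⟩
    obtain ⟨B, hB⟩ := logStern_ae_bounded N
    rw [variance_eq_sub (MemLp.of_bound (integrable_dyadicUniform N _).aestronglyMeasurable B hB)]
    push_cast
    rw [sub_eq_iff_eq_add]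
    exact_mod_cast h2
  -- `80000 = 8/(1/100)²` comes from the second derivative; it also covers the factor 200 of the
  -- first.
  have hdiff (N : ℕ) : ‖deriv (R N) 0 - deriv H 0‖ ≤ 80000 * C * (4 / 5) ^ N ∧
      ‖deriv (deriv (R N)) 0 - deriv (deriv H) 0‖ ≤ 80000 * C * (4 / 5) ^ N := by
    obtain ⟨h1, h2⟩ := norm_deriv_le_of_ball (f := fun z ↦ R N z - H z) (r := 1 / 100) (w := 0)
      (by norm_num) ((hR N).sub hH) (hRH N)
    have e1 (z : ℂ) (hz : z ∈ U) : deriv (fun z ↦ R N z - H z) z = deriv (R N) z - deriv H z :=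
      (((hR N).differentiableAt (hU.mem_nhds hz)).hasDerivAt.sub
        (hH.differentiableAt (hU.mem_nhds hz)).hasDerivAt).deriv
    have he : deriv (fun z ↦ R N z - H z) =ᶠ[nhds 0] fun z ↦ deriv (R N) z - deriv H z := by
      filter_upwards [hUn] with z hz using e1 z hz
    rw [e1 0 h0] at h1
    rw [he.deriv_eq, ((hdd (hR N)).2.hasDerivAt.fun_sub (hdd hH).2.hasDerivAt).deriv] at h2
    have hp : 0 ≤ C * (4 / 5 : ℝ) ^ N := by positivity
    constructor
    · refine h1.trans ?_
      ring_nf at hp ⊢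
      linarith
    · exact h2.trans (le_of_eq (by ring))
  have hC' : 0 ≤ 80000 * C := by positivity
  obtain ⟨hα, hmean⟩ := real_of_affine_approx (e := fun N ↦ ∫ n, logStern n ∂(dyadicUniform N))
    (a := deriv Λ 0) (b := deriv H 0) hC' (by norm_num : (0 : ℝ) ≤ 4 / 5) (by norm_num) fun N ↦ by
      rw [(hcum N).1, add_sub_add_left_eq_sub]
      exact (hdiff N).1
  obtain ⟨hσ, hvar⟩ := real_of_affine_approx (e := fun N ↦ variance logStern (dyadicUniform N))
    (a := deriv (deriv Λ) 0) (b := deriv (deriv H) 0) hC' (by norm_num : (0 : ℝ) ≤ 4 / 5)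
    (by norm_num) fun N ↦ by
      rw [(hcum N).2, add_sub_add_left_eq_sub]
      exact (hdiff N).2
  have hpow (N : ℕ) : 80000 * C * (4 / 5 : ℝ) ^ N ≤ 80000 * C :=
    mul_le_of_le_one_right hC' (pow_le_one₀ (by norm_num) (by norm_num))
  have hαpos : 0 < (deriv Λ 0).re := by
    have : Real.log 2 / 2 ≤ (deriv Λ 0).re :=
      le_of_forall_nat_mul_le (b := (deriv H 0).re + 80000 * C) fun N ↦ by
        have h1 := sternMean_lower N (x := 0) (by simp)
        have h2 := hmean N
        rw [integral_logStern, abs_le] at h2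
        linarith [h2.1, h2.2, hpow N]
    linarith [Real.log_two_gt_d9]
  -- The linear lower bound is known along the times `20k`, hence the factor 20.
  have hσpos : 0 < (deriv (deriv Λ) 0).re := by
    have : (1 / 60 / 2 ^ 19 : ℝ) ≤ (deriv (deriv Λ) 0).re * 20 :=
      le_of_forall_nat_mul_le (b := (deriv (deriv H) 0).re + 80000 * C) fun k ↦ by
        have h1 := sternVar_linear_lower k 0 (by simp)
        have h2 := hvar (20 * k)
        rw [variance_logStern, abs_le] at h2
        push_cast at h2
        linarith [h2.1, h2.2, hpow (20 * k)]
    have h3 : (0 : ℝ) < 1 / 60 / 2 ^ 19 := by positivity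
    linarith
  obtain ⟨B, hB⟩ := (isCompact_closedBall (0 : ℂ) (1 / 200)).exists_bound_of_continuousOn
    (hH.continuousOn.mono hsub)
  have hB0 : 0 ≤ B := (norm_nonneg _).trans (hB 0 (by simp))
  have hsub' : Metric.ball (0 : ℂ) (1 / 200) ⊆ U := Metric.ball_subset_closedBall.trans hsub
  have hle (N : ℕ) : 80000 * C * (4 / 5 : ℝ) ^ N ≤ (80000 * C + B) * (4 / 5) ^ N := by
    gcongr; linarith
  refine ⟨(deriv Λ 0).re, √(deriv (deriv Λ) 0).re, (deriv H 0).re, (deriv (deriv H) 0).re,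
    80000 * C + B, Λ, R, hαpos, Real.sqrt_pos.2 hσpos, fun N ↦ (hmean N).trans (hle N), fun N ↦ ?_,
    hΛ.mono hsub', hΛ0, ?_, ?_, fun N ↦ (hR N).mono hsub', hR0, fun N z hz ↦ ?_, fun N z hz ↦ ?_⟩
  · rw [Real.sq_sqrt hσpos.le]
    exact (hvar N).trans (hle N)
  · exact (Complex.ext rfl (by simpa using hα))
  · rw [← Complex.ofReal_pow, Real.sq_sqrt hσpos.le]
    exact (Complex.ext rfl (by simpa using hσ))
  · have h1 := norm_add_le (R N z - H z) (H z)
    rw [sub_add_cancel] at h1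
    have h2 := hRH N z (hsub' hz)
    have h3 := hB z (Metric.ball_subset_closedBall hz)
    have h4 : C * (4 / 5 : ℝ) ^ N ≤ C := mul_le_of_le_one_right hC (pow_le_one₀ (by norm_num) (by norm_num))
    linarith
  · rw [integral_exp_logStern]
    exact hM N z (hsub' hz)

/-! ### Esseen's smoothing inequality -/

/-- The (unnormalized) Fejér kernel. -/
noncomputable def fejer (y : ℝ) : ℝ := 2 * (1 - Real.cos y) / y ^ 2

theorem fejer_nonneg (y : ℝ) : 0 ≤ fejer y :=
  div_nonneg (by linarith [Real.cos_le_one y]) (sq_nonneg y)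

theorem fejer_le_one (y : ℝ) : fejer y ≤ 1 := by
  refine div_le_one_of_le₀ ?_ (sq_nonneg y)
  linarith [Real.one_sub_sq_div_two_le_cos (x := y)]

theorem fejer_le (y : ℝ) : fejer y ≤ 4 / y ^ 2 :=
  div_le_div_of_nonneg_right (by linarith [Real.neg_one_le_cos y]) (sq_nonneg y)

theorem measurable_fejer : Measurable fejer := by unfold fejer; fun_prop

theorem integrable_fejer : Integrable fejer := by
  refine (integrable_inv_one_add_sq.const_mul 5).mono' measurable_fejer.aestronglyMeasurable
    (Filter.Eventually.of_forall fun y ↦ ?_)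
  rw [Real.norm_of_nonneg (fejer_nonneg y), ← div_eq_mul_inv, le_div_iff₀ (by positivity)]
  have h1 : fejer y * y ^ 2 ≤ 4 := by
    rcases eq_or_ne y 0 with rfl | hy
    · simp
    · have := fejer_le y
      rwa [le_div_iff₀ (by positivity)] at this
  linarith [fejer_le_one y]

theorem integral_fejer_pos : 0 < ∫ y, fejer y := by
  rw [integral_pos_iff_support_of_nonneg fejer_nonneg integrable_fejer]
  refine lt_of_lt_of_le ?_ (measure_mono (s := Set.Ioo (0 : ℝ) 1) fun y hy ↦ ?_)
  · simp
  · have h1 : Real.cos y < Real.cos 0 :=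
      Real.cos_lt_cos_of_nonneg_of_le_pi le_rfl (by linarith [hy.2, Real.pi_gt_three]) hy.1
    rw [Real.cos_zero] at h1
    have h2 : 0 < 2 * (1 - Real.cos y) := by linarith
    have h3 := hy.1
    exact (show 0 < fejer y by unfold fejer; positivity).ne'

theorem integral_fejer_tail {R : ℝ} (hR : 0 < R) :
    ∫ y, Set.indicator {y | R < |y|} fejer y ≤ 8 / R := by
  set g : ℝ → ℝ := Set.indicator (Set.Ioi R) (fun y ↦ 4 * y ^ (-2 : ℝ)) with hg
  have h1 : ∫ y, g |y| = 8 / R := by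
    rw [integral_comp_abs (f := g), hg, setIntegral_indicator measurableSet_Ioi,
      Set.inter_eq_right.2 (Set.Ioi_subset_Ioi hR.le), integral_const_mul,
      integral_Ioi_rpow_of_lt (by norm_num) hR]
    norm_num
    rw [Real.rpow_neg_one]
    ring
  rw [← h1]
  refine integral_mono (integrable_fejer.indicator
    (measurableSet_lt measurable_const (by fun_prop))) ?_ fun y ↦ ?_
  -- A non-integrable function has integral 0 by convention, so the positive value `8/R` certifies
  -- integrability.
  · by_contra hn
    rw [integral_undef hn] at h1
    exact (div_pos (by norm_num) hR).ne h1
  · by_cases hy : R < |y|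
    · rw [Set.indicator_of_mem (show y ∈ {y | R < |y|} from hy), hg,
        Set.indicator_of_mem (show |y| ∈ Set.Ioi R from hy), Real.rpow_neg (abs_nonneg y)]
      refine (fejer_le y).trans (le_of_eq ?_)
      norm_num
      rw [div_eq_mul_inv]
    · rw [Set.indicator_of_notMem (show y ∉ {y | R < |y|} from hy), hg,
        Set.indicator_of_notMem (show |y| ∉ Set.Ioi R from hy)]

/-- The Fejér kernel is the Fourier transform of a function supported in `[-1,1]`; smoothing with it
therefore sees only a bounded range of frequencies. -/
theorem integral_triangle_exp {y : ℝ} (hy : y ≠ 0) :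
    ∫ s in (-1 : ℝ)..1, ((1 - |s| : ℝ) : ℂ) * Complex.exp (Complex.I * (s * y)) = (fejer y : ℂ) := by
  have hyC : (y : ℂ) ≠ 0 := by exact_mod_cast hy
  have hc : (Complex.I * y) ≠ 0 := mul_ne_zero Complex.I_ne_zero (by exact_mod_cast hy)
  have hE (s : ℝ) : HasDerivAt (fun s : ℝ ↦ Complex.exp (Complex.I * (s * y)))
      (Complex.I * y * Complex.exp (Complex.I * (s * y))) s := by
    have h := (((Complex.ofRealCLM.hasDerivAt (x := s)).mul_const (y : ℂ)).const_mul Complex.I).cexp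
    refine h.congr_deriv ?_
    simp only [Complex.ofRealCLM_apply, Complex.ofReal_one]
    ring
  have hs (s : ℝ) : HasDerivAt (fun s : ℝ ↦ (s : ℂ)) 1 s := Complex.ofRealCLM.hasDerivAt (x := s)
  have h1 : ∫ s in (0 : ℝ)..1, ((1 - |s| : ℝ) : ℂ) * Complex.exp (Complex.I * (s * y)) =
      Complex.exp (Complex.I * y) / (Complex.I * y) ^ 2 -
        (1 / (Complex.I * y) + 1 / (Complex.I * y) ^ 2) := by
    rw [intervalIntegral.integral_congr
      (g := fun s : ℝ ↦ (1 - s : ℂ) * Complex.exp (Complex.I * (s * y)))]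
    · rw [intervalIntegral.integral_eq_sub_of_hasDerivAt (f := fun s : ℝ ↦
        (1 - s : ℂ) * Complex.exp (Complex.I * (s * y)) / (Complex.I * y) +
          Complex.exp (Complex.I * (s * y)) / (Complex.I * y) ^ 2)]
      · simp
      · intro s _
        refine (((((hs s).const_sub 1).mul (hE s)).div_const (Complex.I * y)).add
          ((hE s).div_const ((Complex.I * y) ^ 2))).congr_deriv ?_
        field_simp
        ring
      · exact (by fun_prop : Continuous _).intervalIntegrable _ _
    · intro s hs
      rw [Set.uIcc_of_le zero_le_one] at hs
      simp [abs_of_nonneg hs.1]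
  have h2 : ∫ s in (-1 : ℝ)..0, ((1 - |s| : ℝ) : ℂ) * Complex.exp (Complex.I * (s * y)) =
      1 / (Complex.I * y) - 1 / (Complex.I * y) ^ 2 +
        Complex.exp (-(Complex.I * y)) / (Complex.I * y) ^ 2 := by
    rw [intervalIntegral.integral_congr
      (g := fun s : ℝ ↦ (1 + s : ℂ) * Complex.exp (Complex.I * (s * y)))]
    · rw [intervalIntegral.integral_eq_sub_of_hasDerivAt (f := fun s : ℝ ↦
        (1 + s : ℂ) * Complex.exp (Complex.I * (s * y)) / (Complex.I * y) -
          Complex.exp (Complex.I * (s * y)) / (Complex.I * y) ^ 2)]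
      · simp
      · intro s _
        refine (((((hs s).const_add 1).mul (hE s)).div_const (Complex.I * y)).sub
          ((hE s).div_const ((Complex.I * y) ^ 2))).congr_deriv ?_
        field_simp
        ring
      · exact (by fun_prop : Continuous _).intervalIntegrable _ _
    · intro s hs
      rw [Set.uIcc_of_le (by norm_num)] at hs
      simp [abs_of_nonpos hs.2]
  have hcont : Continuous fun s : ℝ ↦ ((1 - |s| : ℝ) : ℂ) * Complex.exp (Complex.I * (s * y)) := by
    fun_prop
  rw [← intervalIntegral.integral_add_adjacent_intervals (hcont.intervalIntegrable _ 0)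
    (hcont.intervalIntegrable _ _), h1, h2, fejer]
  push_cast
  rw [Complex.cos]
  rw [mul_pow, Complex.I_sq, mul_comm Complex.I (y : ℂ), neg_mul]
  field_simp
  ring

/-- Convolution against the rescaled Fejér kernel is controlled by the Fourier transform. -/
theorem norm_integral_fejer_le {D g : ℝ → ℝ} (hD : Integrable D) (hg : Integrable g)
    (hg0 : ∀ s, 0 ≤ g s) {T : ℝ} (hT : 0 < T)
    (h : ∀ s : ℝ, s ≠ 0 → |s| ≤ T → ‖∫ v, (D v : ℂ) * Complex.exp (Complex.I * (s * v))‖ ≤ g s)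
    (x : ℝ) : |∫ y, D (x - y / T) * fejer y| ≤ ∫ s, g s := by
  have hDx : Integrable (fun y ↦ D (x - y / T)) :=
    (hD.comp_sub_left x).comp_div hT.ne'
  -- Rescaling and translation turn the inner Fourier integral into a value of the transform of `D`
  -- at `-T s`, up to a phase and the factor `T`.
  have hin (s : ℝ) : ∫ y : ℝ, (D (x - y / T) : ℂ) * Complex.exp (Complex.I * (s * y)) =
      T * Complex.exp (Complex.I * (s * T * x)) *
        ∫ v, (D v : ℂ) * Complex.exp (Complex.I * ((-(T * s) : ℝ) * v)) := by
    have h1 := Measure.integral_comp_div (fun y : ℝ ↦ (D (x - y) : ℂ) *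
      Complex.exp (Complex.I * (s * (T * y)))) T
    have h2 := integral_sub_left_eq_self (fun y : ℝ ↦ (D y : ℂ) *
      Complex.exp (Complex.I * (s * (T * (x - y))))) (μ := volume) x
    have h2' : ∫ y : ℝ, (D (x - y) : ℂ) * Complex.exp (Complex.I * (s * (T * y))) =
        ∫ y : ℝ, (D y : ℂ) * Complex.exp (Complex.I * (s * (T * (x - y)))) := by
      rw [← h2]
      refine integral_congr_ae (Filter.Eventually.of_forall fun y ↦ ?_)
      simp
    rw [h2', abs_of_pos hT] at h1
    have h3 : ∫ y : ℝ, (D (x - y / T) : ℂ) * Complex.exp (Complex.I * (s * y)) =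
        ∫ y : ℝ, (D (x - y / T) : ℂ) * Complex.exp (Complex.I * (s * (T * (y / T : ℝ)))) := by
      refine integral_congr_ae (Filter.Eventually.of_forall fun y ↦ ?_)
      have : (T : ℂ) ≠ 0 := by exact_mod_cast hT.ne'
      push_cast
      field_simp
    rw [h3, h1, Complex.real_smul, mul_assoc,
      ← integral_const_mul (Complex.exp (Complex.I * (s * T * x)))]
    congr 2 with v
    rw [mul_left_comm (Complex.exp _), ← Complex.exp_add]
    congr 2
    push_cast
    ring
  have hfub : ∫ y : ℝ, ((D (x - y / T) * fejer y : ℝ) : ℂ) = ∫ s in (-1 : ℝ)..1,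
      ((1 - |s| : ℝ) : ℂ) * ∫ y : ℝ, (D (x - y / T) : ℂ) * Complex.exp (Complex.I * (s * y)) := by
    have h1 : ∫ y : ℝ, ((D (x - y / T) * fejer y : ℝ) : ℂ) = ∫ y : ℝ, ∫ s in (-1 : ℝ)..1,
        ((1 - |s| : ℝ) : ℂ) * ((D (x - y / T) : ℂ) * Complex.exp (Complex.I * (s * y))) := by
      refine integral_congr_ae ?_
      -- At `y = 0` the division gives `fejer 0 = 0` rather than the limit 1; this null set is
      -- discarded.
      have : ∀ᵐ y : ℝ, y ≠ 0 := by simp [ae_iff]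
      filter_upwards [this] with y hy
      rw [Complex.ofReal_mul, ← integral_triangle_exp hy, ← intervalIntegral.integral_const_mul]
      exact intervalIntegral.integral_congr fun s _ ↦ mul_left_comm _ _ _
    rw [h1]
    simp only [intervalIntegral.integral_of_le (show (-1 : ℝ) ≤ 1 by norm_num)]
    rw [integral_integral_swap]
    · exact integral_congr_ae (Filter.Eventually.of_forall fun s ↦ integral_const_mul _ _)
    · have hk : Integrable (fun s : ℝ ↦ ((1 - |s| : ℝ) : ℂ)) (volume.restrict (Set.Ioc (-1) 1)) :=
        (by fun_prop : Continuous fun s : ℝ ↦ ((1 - |s| : ℝ) : ℂ)).integrableOn_Ioc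
      have hE : Continuous fun p : ℝ × ℝ ↦ Complex.exp (Complex.I * (p.2 * p.1)) := by fun_prop
      refine ((hDx.ofReal (𝕜 := ℂ).mul_prod hk).mul_bdd (c := 1) hE.aestronglyMeasurable
        (Filter.Eventually.of_forall fun p ↦ ?_)).congr (Filter.Eventually.of_forall fun p ↦ ?_)
      · rw [← Complex.ofReal_mul, mul_comm Complex.I, Complex.norm_exp_ofReal_mul_I]
      · simp only [Function.uncurry, RCLike.ofReal_eq_complex_ofReal]
        ring
  rw [← Real.norm_eq_abs, ← Complex.norm_real, ← integral_complex_ofReal, hfub]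
  have hgT : Integrable (fun s ↦ T * g (-T * s)) := (hg.comp_mul_left' (by linarith)).const_mul T
  calc _ ≤ ∫ s in (-1 : ℝ)..1, T * g (-T * s) := by
        refine intervalIntegral.norm_integral_le_of_norm_le (by norm_num) ?_ hgT.intervalIntegrable
        have : ∀ᵐ y : ℝ, y ≠ 0 := by simp [ae_iff]
        filter_upwards [this] with s hs0 hs
        have hs1 : |s| ≤ 1 := abs_le.2 ⟨hs.1.le, hs.2⟩
        rw [hin, norm_mul, norm_mul, norm_mul, Complex.norm_real, Complex.norm_real,
          Real.norm_of_nonneg hT.le, Real.norm_of_nonneg (by linarith), ← Complex.ofReal_mul,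
          ← Complex.ofReal_mul, mul_comm Complex.I, Complex.norm_exp_ofReal_mul_I, mul_one]
        have h1 := h (-(T * s)) (by simp [hT.ne', hs0]) (by
          rw [abs_neg, abs_mul, abs_of_pos hT]; nlinarith)
        rw [neg_mul]
        calc _ ≤ 1 * (T * g (-(T * s))) := by
              gcongr
              linarith [abs_nonneg s]
          _ = _ := one_mul _
    _ ≤ ∫ s, T * g (-T * s) := by
        rw [intervalIntegral.integral_of_le (by norm_num)]
        exact setIntegral_le_integral hgT
          (Filter.Eventually.of_forall fun s ↦ mul_nonneg hT.le (hg0 _))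
    _ = ∫ s, g s := by
        rw [integral_const_mul, Measure.integral_comp_mul_left, smul_eq_mul, abs_inv, abs_neg,
          abs_of_pos hT, mul_inv_cancel_left₀ hT.ne']

/-- The one-sided half of the smoothing argument. -/
theorem le_integral_fejer_add {D : ℝ → ℝ} (hD : Integrable D) {B d m T x₀ : ℝ}
    (hB : ∀ x, |D x| ≤ B) (hd : 0 < d) (hdB : B ≤ 2 * d) (hm : 0 < m) (hT : 0 < T)
    (h : ∀ s, 0 ≤ s → d - m * s ≤ D (x₀ + s)) :
    d / 2 * ∫ y, fejer y ≤ (∫ y, D (x₀ + d / (4 * m) - y / T) * fejer y) + 80 * (m / T) := by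
  -- The one-sided bound keeps `D ≥ d/2` on `[x₀, x₀ + d/(2m)]`. The kernel is centred at the
  -- midpoint, and `|y| ≤ R` says exactly that `y/T` stays within the half-width `d/(4m)`.
  set R := T * d / (4 * m) with hR
  have hRpos : 0 < R := by positivity
  have hB0 : 0 ≤ B := (abs_nonneg _).trans (hB 0)
  have hS : MeasurableSet {y : ℝ | R < |y|} := measurableSet_lt measurable_const (by fun_prop)
  have hDx : Integrable (fun y ↦ D (x₀ + d / (4 * m) - y / T) * fejer y) :=
    ((hD.comp_sub_left _).comp_div hT.ne').mul_bdd (c := 1) measurable_fejer.aestronglyMeasurable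
      (Filter.Eventually.of_forall fun y ↦ by
        rw [Real.norm_of_nonneg (fejer_nonneg y)]; exact fejer_le_one y)
  have hpt (y : ℝ) : d / 2 * fejer y - 5 * d / 2 * Set.indicator {y | R < |y|} fejer y ≤
      D (x₀ + d / (4 * m) - y / T) * fejer y := by
    have hf := fejer_nonneg y
    by_cases hy : R < |y|
    · rw [Set.indicator_of_mem (show y ∈ {y | R < |y|} from hy)]
      -- Outside that interval only `D ≥ -B ≥ -2d` is available. The loss `5d/2` is multiplied by a
      -- tail of order `1/R`, so `d` cancels and the error is a multiple of `m/T`.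
      have := (abs_le.1 (hB (x₀ + d / (4 * m) - y / T))).1
      nlinarith
    · rw [Set.indicator_of_notMem (show y ∉ {y | R < |y|} from hy), mul_zero, sub_zero]
      refine mul_le_mul_of_nonneg_right ?_ hf
      have hy' := abs_le.1 (not_lt.1 hy)
      have hRT : R / T = d / (4 * m) := by rw [hR]; field_simp
      have h1 : y / T ≤ d / (4 * m) := hRT ▸ div_le_div_of_nonneg_right hy'.2 hT.le
      have h2 : -(d / (4 * m)) ≤ y / T := by
        rw [← hRT, ← neg_div]; exact div_le_div_of_nonneg_right hy'.1 hT.le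
      have h3 := h (d / (4 * m) - y / T) (by linarith)
      rw [add_sub_assoc]
      refine le_trans ?_ h3
      have h4 : m * (d / (4 * m)) = d / 4 := by field_simp
      nlinarith
  have hI := integral_mono ((integrable_fejer.const_mul (d / 2)).sub
    ((integrable_fejer.indicator hS).const_mul (5 * d / 2))) hDx hpt
  simp only [Pi.sub_apply] at hI
  rw [integral_sub (integrable_fejer.const_mul (d / 2))
    ((integrable_fejer.indicator hS).const_mul (5 * d / 2)), integral_const_mul,
    integral_const_mul] at hI
  have ht := mul_le_mul_of_nonneg_left (integral_fejer_tail hRpos)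
    (show 0 ≤ 5 * d / 2 by positivity)
  have e : 5 * d / 2 * (8 / R) = 80 * (m / T) := by rw [hR]; field_simp; norm_num
  rw [e] at ht
  linarith

/-- At a point where `|D|` is at least half its supremum, the one-sided Lipschitz condition keeps
`D` large nearby, so the Fejér average is comparable to the supremum; that average is bounded by the
Fourier transform on `[-T, T]`. -/
theorem abs_le_of_fourier_le : ∃ C : ℝ, 0 < C ∧ ∀ (D g : ℝ → ℝ) (m T : ℝ), Integrable D →
    (∃ B, ∀ x, |D x| ≤ B) → 0 < m → 0 < T → (∀ x s, 0 ≤ s → D x - m * s ≤ D (x + s)) →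
    Integrable g → (∀ s, 0 ≤ g s) →
    (∀ s : ℝ, s ≠ 0 → |s| ≤ T → ‖∫ v, (D v : ℂ) * Complex.exp (Complex.I * (s * v))‖ ≤ g s) →
    ∀ x, |D x| ≤ C * ((∫ s, g s) + m / T) := by
  have hκ := integral_fejer_pos
  set κ := ∫ y, fejer y
  refine ⟨320 / κ, by positivity, ?_⟩
  intro D g m T hD hB hm hT h hg hg0 hfour
  have main : ∀ (D g : ℝ → ℝ) (B d x₀ : ℝ), Integrable D → (∀ x, |D x| ≤ B) → 0 < d → B ≤ 2 * d →
      (∀ x s, 0 ≤ s → D x - m * s ≤ D (x + s)) → Integrable g → (∀ s, 0 ≤ g s) →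
      (∀ s : ℝ, s ≠ 0 → |s| ≤ T → ‖∫ v, (D v : ℂ) * Complex.exp (Complex.I * (s * v))‖ ≤ g s) →
      D x₀ = d → d * κ ≤ 2 * (∫ s, g s) + 160 * (m / T) := by
    intro D g B d x₀ hD hB hd hdB h hg hg0 hfour hx
    have h1 := le_integral_fejer_add hD (x₀ := x₀) hB hd hdB hm hT (fun s hs ↦ hx ▸ h x₀ s hs)
    have h2 := (le_abs_self _).trans (norm_integral_fejer_le hD hg hg0 hT hfour (x₀ + d / (4 * m)))
    linarith
  have hbdd : BddAbove (Set.range fun x ↦ |D x|) := by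
    obtain ⟨B, hB⟩ := hB
    exact ⟨B, by rintro _ ⟨x, rfl⟩; exact hB x⟩
  set B := ⨆ x, |D x| with hBdef
  have hDB (x : ℝ) : |D x| ≤ B := le_ciSup hbdd x
  have hint : 0 ≤ ∫ s, g s := integral_nonneg hg0
  have hmT : 0 < m / T := by positivity
  intro x
  refine (hDB x).trans ?_
  rcases le_or_gt B 0 with hB0 | hB0
  · exact hB0.trans (by positivity)
  obtain ⟨x₀, hx₀⟩ := exists_lt_of_lt_ciSup (show B / 2 < ⨆ x, |D x| by rw [← hBdef]; linarith)
  have key : |D x₀| * κ ≤ 2 * (∫ s, g s) + 160 * (m / T) := by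
    rcases le_or_gt 0 (D x₀) with hx | hx
    · rw [abs_of_nonneg hx] at hx₀ ⊢
      exact main D g B (D x₀) x₀ hD hDB (by linarith) (by linarith) h hg hg0 hfour rfl
    · rw [abs_of_neg hx] at hx₀ ⊢
      -- The reflection `x ↦ -D(-x)` preserves the one-sided condition and reduces negative values
      -- to positive ones.
      have h1 := main (fun x ↦ -D (-x)) (fun s ↦ g (-s)) B (-D x₀) (-x₀) hD.comp_neg.neg
        (fun x ↦ by rw [abs_neg]; exact hDB _) (by linarith) (by linarith) (fun x s hs ↦ by
          have := h (-(x + s)) s hs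
          rw [show -(x + s) + s = -x by ring] at this
          linarith) hg.comp_neg (fun s ↦ hg0 _) (fun s hs0 hs ↦ by
          have := hfour (-s) (by simpa using hs0) (by simpa using hs)
          refine le_trans (le_of_eq ?_) this
          rw [← integral_neg_eq_self, ← norm_neg, ← integral_neg]
          congr 1
          refine integral_congr_ae (Filter.Eventually.of_forall fun v ↦ ?_)
          simp) (by simp)
      rwa [integral_neg_eq_self] at h1
  have h2 : B * κ ≤ 320 * ((∫ s, g s) + m / T) := by nlinarith
  rw [div_mul_eq_mul_div, le_div_iff₀ hκ]
  exact h2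

/-- `1_{x ≤ y} - 1_{0 ≤ y}`. -/
noncomputable def stepDiff (x y : ℝ) : ℝ :=
  Set.indicator (Set.Iic y) 1 x - Set.indicator (Set.Ici 0) 1 y

theorem measurable_stepDiff : Measurable (fun p : ℝ × ℝ ↦ stepDiff p.1 p.2) := by
  unfold stepDiff
  refine Measurable.sub ?_ ((measurable_one.indicator measurableSet_Ici).comp measurable_snd)
  have : (fun p : ℝ × ℝ ↦ Set.indicator (Set.Iic p.2) (1 : ℝ → ℝ) p.1) =
      Set.indicator {p : ℝ × ℝ | p.1 ≤ p.2} 1 := by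
    ext p; simp [Set.indicator]
  rw [this]
  exact measurable_one.indicator (measurableSet_le measurable_fst measurable_snd)

theorem stepDiff_of_nonpos {x : ℝ} (hx : x ≤ 0) :
    stepDiff x = Set.indicator (Set.Ico x 0) 1 := by
  ext y
  simp only [stepDiff, Set.indicator, Set.mem_Iic, Set.mem_Ici, Set.mem_Ico, Pi.one_apply]
  split_ifs <;> grind

theorem stepDiff_of_nonneg {x : ℝ} (hx : 0 ≤ x) :
    stepDiff x = fun y ↦ -Set.indicator (Set.Ico 0 x) 1 y := by
  ext y
  simp only [stepDiff, Set.indicator, Set.mem_Iic, Set.mem_Ici, Set.mem_Ico, Pi.one_apply]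
  split_ifs <;> grind

theorem integrable_stepDiff (x : ℝ) : Integrable (stepDiff x) := by
  have h (a b : ℝ) : Integrable (Set.indicator (Set.Ico a b) (1 : ℝ → ℝ)) :=
    (integrable_indicator_iff measurableSet_Ico).2
      (show IntegrableOn (fun _ ↦ (1 : ℝ)) _ _ from integrableOn_const (by simp))
  rcases le_total x 0 with hx | hx
  · rw [stepDiff_of_nonpos hx]
    exact h _ _
  · rw [stepDiff_of_nonneg hx]
    exact (h _ _).neg

theorem integral_norm_stepDiff (x : ℝ) : ∫ y, ‖stepDiff x y‖ = |x| := by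
  rcases le_total x 0 with hx | hx
  · simp only [stepDiff_of_nonpos hx, norm_indicator_eq_indicator_norm]
    rw [integral_indicator measurableSet_Ico]
    simp [hx, abs_of_nonpos]
  · simp only [stepDiff_of_nonneg hx, norm_neg, norm_indicator_eq_indicator_norm]
    rw [integral_indicator measurableSet_Ico]
    simp [hx, abs_of_nonneg]

theorem integral_stepDiff_mul (x : ℝ) (f : ℝ → ℂ) :
    ∫ y, (stepDiff x y : ℂ) * f y = ∫ y in x..0, f y := by
  rcases le_total x 0 with hx | hx
  · rw [intervalIntegral.integral_of_le hx, ← integral_Ico_eq_integral_Ioc,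
      ← integral_indicator measurableSet_Ico]
    congr 1 with y
    rw [stepDiff_of_nonpos hx]
    by_cases hy : y ∈ Set.Ico x 0 <;> simp [hy]
  · rw [intervalIntegral.integral_of_ge hx, ← integral_Ico_eq_integral_Ioc,
      ← integral_indicator measurableSet_Ico, ← integral_neg]
    congr 1 with y
    rw [stepDiff_of_nonneg hx]
    by_cases hy : y ∈ Set.Ico 0 x <;> simp [hy]

/-! ### Fourier transforms of distribution functions -/

section Cdf

variable (μ : Measure ℝ) [IsProbabilityMeasure μ]

theorem integral_stepDiff (y : ℝ) :
    ∫ x, stepDiff x y ∂μ = μ.real (Set.Iic y) - Set.indicator (Set.Ici 0) 1 y := by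
  unfold stepDiff
  rw [integral_sub ((integrable_const 1).indicator measurableSet_Iic) (integrable_const _),
    integral_indicator_one measurableSet_Iic]
  simp

variable {μ}

omit [IsProbabilityMeasure μ] in
theorem integrable_stepDiff_prod (hμ : Integrable (fun x : ℝ ↦ x) μ) :
    Integrable (fun p : ℝ × ℝ ↦ stepDiff p.1 p.2) (μ.prod volume) := by
  rw [integrable_prod_iff measurable_stepDiff.aestronglyMeasurable]
  refine ⟨Filter.Eventually.of_forall fun x ↦ integrable_stepDiff x, ?_⟩
  simp only [integral_norm_stepDiff]
  exact hμ.abs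

/-- A distribution function is not integrable by itself. Minus the unit step at 0 it is the
`μ`-average of `stepDiff x`, whose `L¹` norm is `|x|`, so a first moment suffices. The step cancels
when two laws are compared. -/
theorem integrable_cdf_sub_step (hμ : Integrable (fun x : ℝ ↦ x) μ) :
    Integrable (fun y ↦ μ.real (Set.Iic y) - Set.indicator (Set.Ici 0) 1 y) := by
  simp only [← integral_stepDiff μ]
  exact (integrable_stepDiff_prod hμ).integral_prod_right

theorem fourier_cdf_sub_step (hμ : Integrable (fun x : ℝ ↦ x) μ) {s : ℝ} (hs : s ≠ 0) :
    ∫ y, ((μ.real (Set.Iic y) - Set.indicator (Set.Ici 0) 1 y : ℝ) : ℂ) *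
      Complex.exp (Complex.I * (s * y)) = (1 - charFun μ s) / (Complex.I * s) := by
  have hc : Complex.I * (s : ℂ) ≠ 0 := mul_ne_zero Complex.I_ne_zero (by exact_mod_cast hs)
  have hE : Continuous fun p : ℝ × ℝ ↦ Complex.exp (Complex.I * (s * p.2)) := by fun_prop
  have hint : Integrable (fun p : ℝ × ℝ ↦ (stepDiff p.1 p.2 : ℂ) *
      Complex.exp (Complex.I * (s * p.2))) (μ.prod volume) := by
    refine (integrable_stepDiff_prod hμ).ofReal.mul_bdd (c := 1) hE.aestronglyMeasurable
      (Filter.Eventually.of_forall fun p ↦ ?_)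
    rw [← Complex.ofReal_mul, mul_comm Complex.I, Complex.norm_exp_ofReal_mul_I]
  have h1 : ∫ y, ((μ.real (Set.Iic y) - Set.indicator (Set.Ici 0) 1 y : ℝ) : ℂ) *
      Complex.exp (Complex.I * (s * y)) =
      ∫ y, ∫ x, (stepDiff x y : ℂ) * Complex.exp (Complex.I * (s * y)) ∂μ := by
    refine integral_congr_ae (Filter.Eventually.of_forall fun y ↦ ?_)
    beta_reduce
    rw [integral_mul_const, ← integral_stepDiff μ, integral_complex_ofReal]
  rw [h1, ← integral_integral_swap hint]
  have h2 (x : ℝ) : ∫ y, (stepDiff x y : ℂ) * Complex.exp (Complex.I * (s * y)) =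
      (1 - Complex.exp (s * x * Complex.I)) / (Complex.I * s) := by
    rw [integral_stepDiff_mul]
    have := integral_exp_mul_complex (a := x) (b := 0) hc
    simp only [mul_assoc] at this
    rw [this]
    simp only [Complex.ofReal_zero, mul_zero, Complex.exp_zero]
    congr 3
    ring
  simp only [h2]
  rw [integral_div, integral_sub (integrable_const _), charFun_apply_real]
  · simp
  · refine (integrable_const (1 : ℝ)).mono' (by fun_prop) (Filter.Eventually.of_forall fun x ↦ ?_)
    rw [← Complex.ofReal_mul, Complex.norm_exp_ofReal_mul_I]

end Cdf

/-- Esseen's smoothing inequality. -/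
theorem esseen_smoothing : ∃ C : ℝ, 0 < C ∧ ∀ (μ ν : Measure ℝ) [IsProbabilityMeasure μ]
    [IsProbabilityMeasure ν] (g : ℝ → ℝ) (m T : ℝ), Integrable (fun x : ℝ ↦ x) μ →
    Integrable (fun x : ℝ ↦ x) ν → 0 < m → 0 < T →
    (∀ x s, 0 ≤ s → ν.real (Set.Iic (x + s)) ≤ ν.real (Set.Iic x) + m * s) →
    Integrable g → (∀ s, 0 ≤ g s) →
    (∀ s : ℝ, |s| ≤ T → ‖charFun μ s - charFun ν s‖ ≤ |s| * g s) →
    ∀ x, |μ.real (Set.Iic x) - ν.real (Set.Iic x)| ≤ C * ((∫ s, g s) + m / T) := by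
  obtain ⟨C, hC, h⟩ := abs_le_of_fourier_le
  refine ⟨C, hC, ?_⟩
  intro μ ν _ _ g m T hμ hν hm hT hlip hg hg0 hchar
  have hi := (integrable_cdf_sub_step hμ).sub (integrable_cdf_sub_step hν)
  have he : (fun y ↦ μ.real (Set.Iic y) - Set.indicator (Set.Ici 0) 1 y) -
      (fun y ↦ ν.real (Set.Iic y) - Set.indicator (Set.Ici 0) 1 y) =
      fun y ↦ μ.real (Set.Iic y) - ν.real (Set.Iic y) := by
    ext y; simp
  rw [he] at hi
  refine h (fun y ↦ μ.real (Set.Iic y) - ν.real (Set.Iic y)) g m T hi ⟨1, fun x ↦ ?_⟩ hm hT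
    (fun x s hs ↦ ?_) hg hg0 fun s hs0 hs ↦ ?_
  · rw [abs_le]
    constructor <;> linarith [measureReal_nonneg (μ := μ) (s := Set.Iic x),
      measureReal_nonneg (μ := ν) (s := Set.Iic x), measureReal_le_one (μ := μ) (s := Set.Iic x),
      measureReal_le_one (μ := ν) (s := Set.Iic x)]
  · have h1 := hlip x s hs
    -- Only the second law needs a Lipschitz distribution function: that of `μ` is monotone, which
    -- suffices for the one-sided condition.
    have h2 : μ.real (Set.Iic x) ≤ μ.real (Set.Iic (x + s)) :=
      measureReal_mono (Set.Iic_subset_Iic.2 (by linarith))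
    linarith
  · have hb {f : ℝ → ℝ} (hf : Integrable f) :
        Integrable fun y ↦ (f y : ℂ) * Complex.exp (Complex.I * (s * y)) := by
      refine hf.ofReal.mul_bdd (c := 1) (by fun_prop) (Filter.Eventually.of_forall fun p ↦ ?_)
      rw [← Complex.ofReal_mul, mul_comm Complex.I, Complex.norm_exp_ofReal_mul_I]
    have e : ∫ v, ((μ.real (Set.Iic v) - ν.real (Set.Iic v) : ℝ) : ℂ) *
        Complex.exp (Complex.I * (s * v)) = (charFun ν s - charFun μ s) / (Complex.I * s) := by
      rw [← sub_sub_sub_cancel_left _ _ (1 : ℂ), sub_div, ← fourier_cdf_sub_step hμ hs0,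
        ← fourier_cdf_sub_step hν hs0,
        ← integral_sub (hb (integrable_cdf_sub_step hμ)) (hb (integrable_cdf_sub_step hν))]
      congr 1 with v
      push_cast
      ring
    rw [e, norm_div, norm_mul, Complex.norm_I, one_mul, Complex.norm_real, Real.norm_eq_abs,
      norm_sub_rev, div_le_iff₀ (abs_pos.2 hs0), mul_comm]
    exact hchar s hs

/-! ### Exponential tilting -/

theorem Complex.norm_exp_sub_one_le_mul_exp (z : ℂ) :
    ‖Complex.exp z - 1‖ ≤ ‖z‖ * Real.exp ‖z‖ := by
  simpa using Complex.norm_exp_sub_sum_le_norm_mul_exp z 1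

theorem setIntegral_integral_Ici (μ : Measure ℝ) [IsProbabilityMeasure μ] {w : ℝ → ℝ}
    (hw : Integrable w) {S : Set ℝ} :
    ∫ x in S, (∫ y in Set.Ici x, w y) ∂μ = ∫ y, w y * μ.real (Set.Iic y ∩ S) := by
  have hm : MeasurableSet {p : ℝ × ℝ | p.1 ≤ p.2} := measurableSet_le measurable_fst measurable_snd
  have hi : Integrable (fun p : ℝ × ℝ ↦ Set.indicator {p : ℝ × ℝ | p.1 ≤ p.2} (fun p ↦ w p.2) p)
      ((μ.restrict S).prod volume) := (hw.comp_snd (μ.restrict S)).indicator hm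
  have h1 (x : ℝ) : ∫ y in Set.Ici x, w y =
      ∫ y, Set.indicator {p : ℝ × ℝ | p.1 ≤ p.2} (fun p ↦ w p.2) (x, y) := by
    rw [← integral_indicator measurableSet_Ici]
    rfl
  simp only [h1]
  rw [integral_integral_swap (f := fun x y ↦
    Set.indicator {p : ℝ × ℝ | p.1 ≤ p.2} (fun p ↦ w p.2) (x, y)) hi]
  congr 1 with y
  have h2 : (fun x ↦ Set.indicator {p : ℝ × ℝ | p.1 ≤ p.2} (fun p ↦ w p.2) (x, y)) =
      Set.indicator (Set.Iic y) (fun _ ↦ w y) := by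
    ext x; simp [Set.indicator]
  rw [h2, integral_indicator_const _ measurableSet_Iic, smul_eq_mul, mul_comm,
    measureReal_restrict_apply measurableSet_Iic]

theorem abs_integral_mul_sub_le {w f g : ℝ → ℝ} (hw : Integrable w) (hw0 : ∀ y, 0 ≤ w y)
    (hw1 : ∫ y, w y = 1) (hf : Measurable f) (hg : Measurable g) {Δ : ℝ}
    (hf1 : ∀ y, |f y| ≤ 1) (hg1 : ∀ y, |g y| ≤ 1) (h : ∀ y, w y ≠ 0 → |f y - g y| ≤ Δ) :
    |(∫ y, w y * f y) - ∫ y, w y * g y| ≤ Δ := by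
  have h1 := hw.mul_bdd (c := 1) hf.aestronglyMeasurable (Filter.Eventually.of_forall hf1)
  have h2 := hw.mul_bdd (c := 1) hg.aestronglyMeasurable (Filter.Eventually.of_forall hg1)
  rw [← integral_sub h1 h2, ← Real.norm_eq_abs]
  refine (norm_integral_le_of_norm_le (hw.mul_const Δ)
    (Filter.Eventually.of_forall fun y ↦ ?_)).trans (le_of_eq ?_)
  · rw [← mul_sub, norm_mul, Real.norm_of_nonneg (hw0 y)]
    by_cases hy : w y = 0
    · simp [hy]
    · exact mul_le_mul_of_nonneg_left (h y hy) (hw0 y)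
  · rw [integral_mul_const, hw1, one_mul]

section Tail

variable {μ ν : Measure ℝ} [IsProbabilityMeasure μ] [IsProbabilityMeasure ν] {Δ : ℝ}

theorem monotone_measureReal_Iic_inter (μ : Measure ℝ) [IsProbabilityMeasure μ] (S : Set ℝ) :
    Monotone fun y ↦ μ.real (Set.Iic y ∩ S) := fun _ _ h ↦
  measureReal_mono (Set.inter_subset_inter_left _ (Set.Iic_subset_Iic.2 h))

theorem abs_measureReal_le_one (μ : Measure ℝ) [IsProbabilityMeasure μ] (S : Set ℝ) :
    |μ.real S| ≤ 1 := by
  rw [abs_of_nonneg measureReal_nonneg]; exact measureReal_le_one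

/-- Comparison of exponential tail integrals, from a bound on the distance of the distribution
functions: the right tail. -/
theorem abs_integral_Ioi_exp_sub_le
    (h : ∀ x, |μ.real (Set.Iic x) - ν.real (Set.Iic x)| ≤ Δ) {t : ℝ} (ht : 0 < t) :
    |(∫ x in Set.Ioi 0, Real.exp (-t * x) ∂μ) - ∫ x in Set.Ioi 0, Real.exp (-t * x) ∂ν| ≤ 2 * Δ := by
  -- `w` is a probability density, and `exp(-t x)` is its mass beyond `x` for `x > 0`. The tail
  -- integral is thus a `w`-average of `μ((0,y])`, and the two endpoints cost `2Δ`.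
  set w : ℝ → ℝ := Set.indicator (Set.Ioi 0) fun y ↦ t * Real.exp (-t * y) with hwdef
  have hwon (c : ℝ) : IntegrableOn (fun y ↦ t * Real.exp (-t * y)) (Set.Ioi c) :=
    (integrableOn_exp_mul_Ioi (neg_neg_of_pos ht) c).const_mul t
  have hw : Integrable w := (hwon 0).integrable_indicator measurableSet_Ioi
  have hint (c : ℝ) : ∫ y in Set.Ioi c, t * Real.exp (-t * y) = Real.exp (-t * c) := by
    rw [integral_const_mul, integral_exp_mul_Ioi (neg_neg_of_pos ht)]
    field_simp
  have hw1 : ∫ y, w y = 1 := by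
    rw [hwdef, integral_indicator measurableSet_Ioi, hint]; simp
  have key (μ : Measure ℝ) [IsProbabilityMeasure μ] :
      ∫ x in Set.Ioi 0, Real.exp (-t * x) ∂μ = ∫ y, w y * μ.real (Set.Iic y ∩ Set.Ioi 0) := by
    rw [← setIntegral_integral_Ici μ hw]
    refine setIntegral_congr_fun measurableSet_Ioi fun x hx ↦ ?_
    rw [integral_Ici_eq_integral_Ioi, ← hint]
    refine setIntegral_congr_fun measurableSet_Ioi fun y hy ↦ ?_
    rw [hwdef, Set.indicator_of_mem (show y ∈ Set.Ioi (0 : ℝ) from lt_trans (Set.mem_Ioi.1 hx) (Set.mem_Ioi.1 hy))]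
  rw [key, key]
  refine abs_integral_mul_sub_le hw (fun y ↦ Set.indicator_nonneg (fun _ _ ↦ by positivity) y) hw1
    (monotone_measureReal_Iic_inter μ _).measurable (monotone_measureReal_Iic_inter ν _).measurable
    (fun y ↦ abs_measureReal_le_one _ _) (fun y ↦ abs_measureReal_le_one _ _) fun y hy ↦ ?_
  have hy0 : 0 ≤ y := by
    by_contra hn
    exact hy (Set.indicator_of_notMem (fun hm : y ∈ Set.Ioi (0 : ℝ) ↦ hn (le_of_lt hm)) _)
  have e (μ : Measure ℝ) [IsProbabilityMeasure μ] :
      μ.real (Set.Iic y ∩ Set.Ioi 0) = μ.real (Set.Iic y) - μ.real (Set.Iic 0) := by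
    rw [← measureReal_sdiff (Set.Iic_subset_Iic.2 hy0) measurableSet_Iic]
    congr 1
    ext x
    simp [and_comm]
  rw [e, e]
  have h1 := abs_le.1 (h y)
  have h2 := abs_le.1 (h 0)
  rw [abs_le]
  constructor <;> linarith [h1.1, h1.2, h2.1, h2.2]

/-- Comparison of exponential tail integrals: the left tail. -/
theorem abs_integral_Iic_exp_sub_le
    (h : ∀ x, |μ.real (Set.Iic x) - ν.real (Set.Iic x)| ≤ Δ) {t : ℝ} (ht : t < 0) :
    |(∫ x in Set.Iic 0, Real.exp (-t * x) ∂μ) - ∫ x in Set.Iic 0, Real.exp (-t * x) ∂ν| ≤ 2 * Δ := by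
  have ht' : 0 < -t := by linarith
  set w : ℝ → ℝ := Set.indicator (Set.Iic 0) fun y ↦ -t * Real.exp (-t * y) with hwdef
  have hwon (c : ℝ) : IntegrableOn (fun y ↦ -t * Real.exp (-t * y)) (Set.Iic c) :=
    (integrableOn_exp_mul_Iic ht' c).const_mul (-t)
  have hw : Integrable w := (hwon 0).integrable_indicator measurableSet_Iic
  have hint (c : ℝ) : ∫ y in Set.Iic c, -t * Real.exp (-t * y) = Real.exp (-t * c) := by
    rw [integral_const_mul, integral_exp_mul_Iic ht', mul_div_cancel₀ _ ht'.ne']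
  have hw1 : ∫ y, w y = 1 := by
    rw [hwdef, integral_indicator measurableSet_Iic, hint]; simp
  -- For `x ≤ 0` the mass of `w` beyond `x` is `1 - exp(-t x)`, hence the extra term `μ.real
  -- (Set.Iic 0)`, which accounts for the second `Δ`.
  have key (μ : Measure ℝ) [IsProbabilityMeasure μ] :
      ∫ x in Set.Iic 0, Real.exp (-t * x) ∂μ =
        μ.real (Set.Iic 0) - ∫ y, w y * μ.real (Set.Iic y ∩ Set.Iic 0) := by
    rw [← setIntegral_integral_Ici μ hw]
    have hcongr : Set.EqOn (fun x ↦ ∫ y in Set.Ici x, w y) (fun x ↦ 1 - Real.exp (-t * x))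
        (Set.Iic 0) := by
      intro x hx
      beta_reduce
      rw [← hw1, ← hint, integral_Ici_eq_integral_Ioi, ← Set.compl_Iic,
        setIntegral_compl measurableSet_Iic hw]
      congr 1
      refine setIntegral_congr_fun measurableSet_Iic fun y hy ↦ ?_
      rw [hwdef, Set.indicator_of_mem (show y ∈ Set.Iic (0 : ℝ) from le_trans (Set.mem_Iic.1 hy) (Set.mem_Iic.1 hx))]
    have hexp : Integrable (fun x ↦ Real.exp (-t * x)) (μ.restrict (Set.Iic 0)) := by
      refine (integrable_const (1 : ℝ)).mono' (by fun_prop) ?_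
      filter_upwards [ae_restrict_mem measurableSet_Iic] with x hx
      rw [Real.norm_of_nonneg (Real.exp_pos _).le, Real.exp_le_one_iff]
      exact mul_nonpos_of_nonneg_of_nonpos ht'.le hx
    rw [setIntegral_congr_fun measurableSet_Iic hcongr, integral_sub (integrable_const _) hexp]
    simp
  rw [key, key]
  have h0 : |(∫ y, w y * μ.real (Set.Iic y ∩ Set.Iic 0)) -
      ∫ y, w y * ν.real (Set.Iic y ∩ Set.Iic 0)| ≤ Δ := by
    refine abs_integral_mul_sub_le hw (fun y ↦ Set.indicator_nonneg (fun _ _ ↦ by positivity) y) hw1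
      (monotone_measureReal_Iic_inter μ _).measurable
      (monotone_measureReal_Iic_inter ν _).measurable
      (fun y ↦ abs_measureReal_le_one _ _) (fun y ↦ abs_measureReal_le_one _ _) fun y hy ↦ ?_
    rw [Set.Iic_inter_Iic]
    exact h _
  have h1 := abs_le.1 h0
  have h2 := abs_le.1 (h 0)
  rw [abs_le]
  constructor <;> linarith [h1.1, h1.2, h2.1, h2.2]

end Tail

/-! ### The standard Gaussian -/

theorem gaussianPDFReal_std (x : ℝ) :
    gaussianPDFReal 0 1 x = Real.exp (-x ^ 2 / 2) / √(2 * Real.pi) := by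
  simp [gaussianPDFReal, div_eq_inv_mul]

theorem gaussianPDFReal_std_le_one (x : ℝ) : gaussianPDFReal 0 1 x ≤ 1 := by
  rw [gaussianPDFReal_std]
  refine div_le_one_of_le₀ ?_ (Real.sqrt_nonneg _)
  have h1 : Real.exp (-x ^ 2 / 2) ≤ 1 := Real.exp_le_one_iff.2 (by nlinarith [sq_nonneg x])
  have h2 : (1 : ℝ) ≤ √(2 * Real.pi) := Real.one_le_sqrt.2 (by linarith [Real.pi_gt_three])
  linarith

theorem gaussianReal_std_real (S : Set ℝ) :
    (gaussianReal 0 1).real S = ∫ x in S, gaussianPDFReal 0 1 x := by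
  rw [measureReal_def, gaussianReal_apply_eq_integral 0 one_ne_zero, ENNReal.toReal_ofReal]
  exact integral_nonneg fun x ↦ gaussianPDFReal_nonneg _ _ x

theorem gaussianReal_std_Iic_lipschitz (x s : ℝ) (hs : 0 ≤ s) :
    (gaussianReal 0 1).real (Set.Iic (x + s)) ≤ (gaussianReal 0 1).real (Set.Iic x) + 1 * s := by
  have h1 : Set.Iic (x + s) = Set.Iic x ∪ Set.Ioc x (x + s) :=
    (Set.Iic_union_Ioc_eq_Iic (by linarith)).symm
  rw [h1]
  refine (measureReal_union_le _ _).trans (add_le_add le_rfl ?_)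
  rw [gaussianReal_std_real]
  have h2 : ∫ y in Set.Ioc x (x + s), gaussianPDFReal 0 1 y ≤ ∫ y in Set.Ioc x (x + s), (1 : ℝ) :=
    setIntegral_mono (integrable_gaussianPDFReal 0 1).integrableOn (by simp)
      fun y ↦ gaussianPDFReal_std_le_one y
  refine h2.trans ?_
  simp [hs]

theorem setIntegral_gaussianReal_std {S : Set ℝ} (hS : MeasurableSet S) (f : ℝ → ℝ) :
    ∫ x in S, f x ∂(gaussianReal 0 1) = ∫ x in S, gaussianPDFReal 0 1 x * f x := by
  rw [← integral_indicator hS, integral_gaussianReal_eq_integral_smul one_ne_zero,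
    ← integral_indicator hS]
  congr 1 with x
  by_cases hx : x ∈ S <;> simp [hx]

/-- Completing the square: tilting the Gaussian amounts to translating it by `t`. -/
theorem exp_mul_integral_exp_gaussian {S : Set ℝ} (hS : MeasurableSet S) (t : ℝ) :
    Real.exp (-t ^ 2 / 2) * ∫ x in S, Real.exp (-t * x) ∂(gaussianReal 0 1) =
      (gaussianReal 0 1).real ((fun x ↦ x - t) ⁻¹' S) := by
  rw [setIntegral_gaussianReal_std hS, gaussianReal_std_real, ← integral_const_mul,
    ← integral_indicator hS, ← integral_indicator (hS.preimage (by fun_prop)),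
    ← integral_add_right_eq_self (Set.indicator ((fun x ↦ x - t) ⁻¹' S) _) t]
  congr 1 with x
  by_cases hx : x ∈ S
  · rw [Set.indicator_of_mem hx, Set.indicator_of_mem (by simpa using hx), gaussianPDFReal_std,
      gaussianPDFReal_std, div_mul_eq_mul_div, mul_div_assoc', ← Real.exp_add, ← Real.exp_add]
    congr 2
    ring
  · rw [Set.indicator_of_notMem hx, Set.indicator_of_notMem (by simpa using hx)]

/-- The density is at most 1. This Mills-type decay later absorbs a factor `|t|`, so that the final
error carries `1 + t²` and not a cubic in `|t|`. -/
theorem mul_integral_Ioi_exp_gaussian_le {t : ℝ} (ht : 0 < t) :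
    |t| * ∫ x in Set.Ioi 0, Real.exp (-t * x) ∂(gaussianReal 0 1) ≤ 1 := by
  have h1 : ∫ x in Set.Ioi 0, Real.exp (-t * x) ∂(gaussianReal 0 1) ≤
      ∫ x in Set.Ioi 0, Real.exp (-t * x) := by
    have hi := integrableOn_exp_mul_Ioi (neg_neg_of_pos ht) 0
    rw [setIntegral_gaussianReal_std measurableSet_Ioi]
    refine setIntegral_mono (hi.bdd_mul (c := 1)
      (measurable_gaussianPDFReal 0 1).aestronglyMeasurable (Filter.Eventually.of_forall fun x ↦ ?_))
      hi fun x ↦ mul_le_of_le_one_left (Real.exp_pos _).le (gaussianPDFReal_std_le_one x)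
    rw [Real.norm_of_nonneg (gaussianPDFReal_nonneg _ _ _)]
    exact gaussianPDFReal_std_le_one x
  rw [integral_exp_mul_Ioi (neg_neg_of_pos ht)] at h1
  rw [abs_of_pos ht]
  calc _ ≤ t * _ := mul_le_mul_of_nonneg_left h1 ht.le
    _ = 1 := by simp; field_simp

theorem mul_integral_Iic_exp_gaussian_le {t : ℝ} (ht : t < 0) :
    |t| * ∫ x in Set.Iic 0, Real.exp (-t * x) ∂(gaussianReal 0 1) ≤ 1 := by
  have ht' : 0 < -t := by linarith
  have h1 : ∫ x in Set.Iic 0, Real.exp (-t * x) ∂(gaussianReal 0 1) ≤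
      ∫ x in Set.Iic 0, Real.exp (-t * x) := by
    have hi := integrableOn_exp_mul_Iic ht' 0
    rw [setIntegral_gaussianReal_std measurableSet_Iic]
    refine setIntegral_mono (hi.bdd_mul (c := 1)
      (measurable_gaussianPDFReal 0 1).aestronglyMeasurable (Filter.Eventually.of_forall fun x ↦ ?_))
      hi fun x ↦ mul_le_of_le_one_left (Real.exp_pos _).le (gaussianPDFReal_std_le_one x)
    rw [Real.norm_of_nonneg (gaussianPDFReal_nonneg _ _ _)]
    exact gaussianPDFReal_std_le_one x
  rw [integral_exp_mul_Iic ht'] at h1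
  rw [abs_of_neg ht]
  calc _ ≤ -t * _ := mul_le_mul_of_nonneg_left h1 ht'.le
    _ = 1 := by rw [mul_div_cancel₀ _ ht'.ne']; simp

theorem integrable_one_add_sq_mul_exp :
    Integrable fun u : ℝ ↦ (1 + u ^ 2) * Real.exp (-u ^ 2 / 4) := by
  have h1 := integrable_exp_neg_mul_sq (b := 1 / 4) (by norm_num)
  have h2 := integrable_rpow_mul_exp_neg_mul_sq (b := 1 / 4) (by norm_num) (s := 2) (by norm_num)
  refine (h1.add h2).congr (Filter.Eventually.of_forall fun u ↦ ?_)
  simp only [Pi.add_apply, Real.rpow_two]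
  rw [show -(1 / 4) * u ^ 2 = -u ^ 2 / 4 by ring]
  ring

theorem integrable_cexp_of_bounded {ρ : Measure ℝ} [IsProbabilityMeasure ρ] {B : ℝ}
    (hB : ∀ᵐ x ∂ρ, |x| ≤ B) (t : ℝ) : Integrable (fun x ↦ Real.exp (t * x)) ρ := by
  refine (integrable_const (Real.exp (|t| * B))).mono' (by fun_prop) ?_
  filter_upwards [hB] with x hx
  rw [Real.norm_of_nonneg (Real.exp_pos _).le, Real.exp_le_exp]
  calc t * x ≤ |t * x| := le_abs_self _
    _ = |t| * |x| := abs_mul _ _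
    _ ≤ |t| * B := by gcongr

theorem charFun_tilted_mul {ρ : Measure ℝ} [IsProbabilityMeasure ρ] (t u : ℝ) :
    charFun (ρ.tilted (t * ·)) u =
      (∫ x, Complex.exp ((t + u * Complex.I) * x) ∂ρ) / (∫ x, Real.exp (t * x) ∂ρ : ℝ) := by
  rw [charFun_apply_real, integral_tilted, ← integral_div]
  congr 1 with x
  rw [Complex.real_smul, add_mul, Complex.exp_add]
  push_cast
  rw [div_mul_eq_mul_div]
  congr 3
  ring

/-- A Gaussian approximation for the tilted law `ρ`, given its Laplace transform on a vertical
segment, transfers to a bound for `ρ` with Gaussian decay in the tilting parameter. -/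
theorem abs_cdf_sub_gaussian_le_of_laplace (A : ℝ) : ∃ C : ℝ, 0 < C ∧
    ∀ (ρ : Measure ℝ) [IsProbabilityMeasure ρ] (B t b T : ℝ) (E : ℂ → ℂ),
    (∀ᵐ x ∂ρ, |x| ≤ B) → 0 ≤ b → 0 < T →
    (∀ u : ℝ, |u| ≤ T → ∫ x, Complex.exp ((t + u * Complex.I) * x) ∂ρ =
      Complex.exp ((t + u * Complex.I) ^ 2 / 2 - t * (t + u * Complex.I) + E (t + u * Complex.I))) →
    (∀ u : ℝ, |u| ≤ T → ‖E (t + u * Complex.I) - E t‖ ≤ |u| * (b * (1 + t ^ 2 + u ^ 2))) →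
    (∀ u : ℝ, |u| ≤ T → ‖E (t + u * Complex.I) - E t‖ ≤ A + u ^ 2 / 4) →
    ‖E t‖ ≤ b * (1 + t ^ 2) * |t| → ‖E t‖ ≤ A →
    |ρ.real (Set.Iic 0) - (gaussianReal 0 1).real (Set.Iic t)| ≤
      C * (b + 1 / T) * ((1 + t ^ 2) * Real.exp (-t ^ 2 / 2)) := by
  obtain ⟨C, hC, hess⟩ := esseen_smoothing
  set G : ℝ → ℝ := fun u ↦ (1 + u ^ 2) * Real.exp (-u ^ 2 / 4) with hG
  have hGi : Integrable G := integrable_one_add_sq_mul_exp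
  have hG0 (u : ℝ) : 0 ≤ G u := by simp only [hG]; positivity
  set I := ∫ u, G u with hI
  have hI0 : 0 ≤ I := integral_nonneg hG0
  refine ⟨Real.exp A * (2 * (C * (Real.exp A * I + 1)) + 1), by positivity, ?_⟩
  intro ρ _ B t b T E hB hb hT hL hE1 hE2 hE3 hE4
  have hexp := integrable_cexp_of_bounded hB t
  set Z := ∫ x, Real.exp (t * x) ∂ρ with hZ
  have hZpos : 0 < Z := integral_exp_pos hexp
  have hZc : (Z : ℂ) = Complex.exp (-t ^ 2 / 2 + E t) := by
    have h := hL 0 (by simpa using hT.le)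
    simp only [Complex.ofReal_zero, zero_mul, add_zero] at h
    rw [show (t : ℂ) ^ 2 / 2 - t * t + E t = -t ^ 2 / 2 + E t by ring] at h
    rw [← h, hZ, ← integral_complex_ofReal]
    congr 1 with x
    push_cast
    rfl
  set μ := ρ.tilted (t * ·) with hμ
  have : IsProbabilityMeasure μ := isProbabilityMeasure_tilted hexp
  set ν := gaussianReal 0 1 with hν
  have hμid : Integrable (fun x : ℝ ↦ x) μ := by
    refine (integrable_const B).mono' (by fun_prop) ?_
    exact (tilted_absolutelyContinuous ρ _).ae_le hB
  have hνid : Integrable (fun x : ℝ ↦ x) ν :=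
    (memLp_id_gaussianReal 1).integrable (by simp)
  have hchar (u : ℝ) (hu : |u| ≤ T) : ‖charFun μ u - charFun ν u‖ ≤
      |u| * (b * (1 + t ^ 2) * Real.exp A * G u) := by
    -- With `w = t + iu` one has `w²/2 - t w = -t²/2 - u²/2`: the tilted law is a standard Gaussian
    -- up to the increment of `E`.
    have h1 : charFun μ u = Complex.exp (-u ^ 2 / 2) * Complex.exp (E (t + u * Complex.I) - E t) := by
      rw [hμ, charFun_tilted_mul, hL u hu, hZc, ← Complex.exp_sub, ← Complex.exp_add]
      congr 1
      ring_nf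
      rw [Complex.I_sq]
      ring
    have h2 : charFun ν u = Complex.exp (-u ^ 2 / 2) := by
      rw [hν, charFun_gaussianReal]
      congr 1
      simp
      ring
    have h3 : ‖Complex.exp (-u ^ 2 / 2 : ℂ)‖ = Real.exp (-u ^ 2 / 2) := by
      rw [Complex.norm_exp]
      congr 1
      norm_cast
    rw [h1, h2, ← mul_sub_one, norm_mul, h3]
    have h4 := Complex.norm_exp_sub_one_le_mul_exp (E (t + u * Complex.I) - E t)
    have h5 := hE1 u hu
    have h6 := Real.exp_le_exp.2 (hE2 u hu)
    calc _ ≤ Real.exp (-u ^ 2 / 2) * (|u| * (b * (1 + t ^ 2 + u ^ 2)) * Real.exp (A + u ^ 2 / 4)) := by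
          gcongr
          exact h4.trans (by gcongr)
      _ ≤ Real.exp (-u ^ 2 / 2) *
          (|u| * (b * ((1 + t ^ 2) * (1 + u ^ 2))) * Real.exp (A + u ^ 2 / 4)) := by
          gcongr
          nlinarith [mul_nonneg (sq_nonneg t) (sq_nonneg u)]
      _ = _ := by
          rw [Real.exp_add, hG]
          have : Real.exp (-u ^ 2 / 4) = Real.exp (-u ^ 2 / 2) * Real.exp (u ^ 2 / 4) := by
            rw [← Real.exp_add]; congr 1; ring
          simp only [this]
          ring
  set Δ := C * (b * (1 + t ^ 2) * Real.exp A * I + 1 / T) with hΔ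
  have hcdf (x : ℝ) : |μ.real (Set.Iic x) - ν.real (Set.Iic x)| ≤ Δ := by
    have := hess μ ν (fun u ↦ b * (1 + t ^ 2) * Real.exp A * G u) 1 T hμid hνid one_pos hT
      gaussianReal_std_Iic_lipschitz (hGi.const_mul _)
      (fun u ↦ mul_nonneg (by positivity) (hG0 u)) hchar x
    rwa [integral_const_mul] at this
  have hΔ0 : 0 ≤ Δ := by positivity
  -- Undoing the tilt, `ρ(S)` is `Z` times the integral of `exp(-t x)` over `S` against `μ`. The two
  -- errors, from `μ` against `ν` and from `Z` against `exp(-t²/2)`, both carry the factor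
  -- `exp(-t²/2)`.
  have comb (S : Set ℝ) (hS : MeasurableSet S)
      (hJ : |(∫ x in S, Real.exp (-t * x) ∂μ) - ∫ x in S, Real.exp (-t * x) ∂ν| ≤ 2 * Δ)
      (hJν : |t| * ∫ x in S, Real.exp (-t * x) ∂ν ≤ 1) :
      |ρ.real S - ν.real ((fun x ↦ x - t) ⁻¹' S)| ≤
        Real.exp (-t ^ 2 / 2) * (Real.exp A * (2 * Δ + b * (1 + t ^ 2))) := by
    rw [← exp_mul_integral_exp_gaussian hS t]
    have hρ : ρ.real S = Z * ∫ x in S, Real.exp (-t * x) ∂μ := by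
      rw [hμ, setIntegral_tilted, ← hZ, ← integral_const_mul]
      have (x : ℝ) : Z * (Real.exp (t * x) / Z) • Real.exp (-t * x) = 1 := by
        rw [smul_eq_mul, ← mul_assoc, mul_div_cancel₀ _ hZpos.ne', ← Real.exp_add]
        simp
      simp only [this]
      simp
    have hJν0 : 0 ≤ ∫ x in S, Real.exp (-t * x) ∂ν := integral_nonneg fun x ↦ (Real.exp_pos _).le
    rw [hρ]
    set J := ∫ x in S, Real.exp (-t * x) ∂μ
    set J' := ∫ x in S, Real.exp (-t * x) ∂ν
    have h3 : ‖Complex.exp (-t ^ 2 / 2 : ℂ)‖ = Real.exp (-t ^ 2 / 2) := by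
      rw [Complex.norm_exp]
      congr 1
      norm_cast
    have hZ1 : |Z| ≤ Real.exp (-t ^ 2 / 2) * Real.exp A := by
      rw [← Real.norm_eq_abs, ← Complex.norm_real, hZc, Complex.exp_add, norm_mul, h3]
      gcongr
      exact (Complex.norm_exp_le_exp_norm _).trans (Real.exp_le_exp.2 hE4)
    have hZ2 : |Z - Real.exp (-t ^ 2 / 2)| ≤
        Real.exp (-t ^ 2 / 2) * (b * (1 + t ^ 2) * |t| * Real.exp A) := by
      rw [← Real.norm_eq_abs, ← Complex.norm_real]
      push_cast
      rw [hZc, Complex.exp_add, ← mul_sub_one, norm_mul, h3]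
      gcongr
      exact (Complex.norm_exp_sub_one_le_mul_exp _).trans (by gcongr)
    calc |Z * J - Real.exp (-t ^ 2 / 2) * J'| = |Z * (J - J') + (Z - Real.exp (-t ^ 2 / 2)) * J'| := by
          congr 1; ring
      _ ≤ |Z| * |J - J'| + |Z - Real.exp (-t ^ 2 / 2)| * J' := by
          refine (abs_add_le _ _).trans ?_
          rw [abs_mul, abs_mul, abs_of_nonneg hJν0]
      _ ≤ Real.exp (-t ^ 2 / 2) * Real.exp A * (2 * Δ) +
          Real.exp (-t ^ 2 / 2) * (b * (1 + t ^ 2) * |t| * Real.exp A) * J' := by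
          gcongr
      _ = Real.exp (-t ^ 2 / 2) *
          (Real.exp A * (2 * Δ + b * (1 + t ^ 2) * (|t| * J'))) := by ring
      _ ≤ _ := by
          have := mul_le_of_le_one_right (show 0 ≤ b * (1 + t ^ 2) by positivity) hJν
          refine mul_le_mul_of_nonneg_left (mul_le_mul_of_nonneg_left ?_ (Real.exp_pos _).le)
            (Real.exp_pos _).le
          linarith
  have hfin : Real.exp (-t ^ 2 / 2) * (Real.exp A * (2 * Δ + b * (1 + t ^ 2))) ≤
      Real.exp A * (2 * (C * (Real.exp A * I + 1)) + 1) * (b + 1 / T) *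
        ((1 + t ^ 2) * Real.exp (-t ^ 2 / 2)) := by
    have hT' : 0 ≤ 1 / T := by positivity
    have h1 : Δ ≤ C * (Real.exp A * I + 1) * (b + 1 / T) * (1 + t ^ 2) := by
      rw [hΔ]
      have e : C * (Real.exp A * I + 1) * (b + 1 / T) * (1 + t ^ 2) =
          C * (b * (1 + t ^ 2) * Real.exp A * I + 1 / T + (b * (1 + t ^ 2) +
            1 / T * (t ^ 2) + 1 / T * (Real.exp A * I * (1 + t ^ 2)))) := by ring
      rw [e]
      refine mul_le_mul_of_nonneg_left ?_ hC.le
      rw [le_add_iff_nonneg_right]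
      positivity
    have h2 : b * (1 + t ^ 2) ≤ (b + 1 / T) * (1 + t ^ 2) := by gcongr; linarith
    calc _ ≤ Real.exp (-t ^ 2 / 2) * (Real.exp A *
          (2 * (C * (Real.exp A * I + 1) * (b + 1 / T) * (1 + t ^ 2)) + (b + 1 / T) * (1 + t ^ 2))) := by
          gcongr
      _ = _ := by ring
  have hpreIic : (fun x ↦ x - t) ⁻¹' Set.Iic 0 = Set.Iic t := by ext; simp
  have hpreIoi : (fun x ↦ x - t) ⁻¹' Set.Ioi 0 = (Set.Iic t)ᶜ := by ext; simp
  -- The half-line is chosen according to the sign of `t`, so that `exp(-t x) ≤ 1` on it.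
  rcases lt_trichotomy t 0 with ht | ht | ht
  · have := comb (Set.Iic 0) measurableSet_Iic (abs_integral_Iic_exp_sub_le hcdf ht)
      (mul_integral_Iic_exp_gaussian_le ht)
    rw [hpreIic] at this
    exact this.trans hfin
  · have := comb (Set.Iic 0) measurableSet_Iic (by
      have h0 := hcdf 0
      simp only [ht, neg_zero, zero_mul, Real.exp_zero, setIntegral_const, smul_eq_mul, mul_one] at *
      linarith) (by simp [ht])
    rw [hpreIic] at this
    exact this.trans hfin
  · have := comb (Set.Ioi 0) measurableSet_Ioi (abs_integral_Ioi_exp_sub_le hcdf ht)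
      (mul_integral_Ioi_exp_gaussian_le ht)
    rw [hpreIoi, ← Set.compl_Iic, probReal_compl_eq_one_sub measurableSet_Iic,
      probReal_compl_eq_one_sub measurableSet_Iic, sub_sub_sub_cancel_left, abs_sub_comm] at this
    exact this.trans hfin

/-! ### Moderate deviations from quasi-powers -/

/-- Integrating a bound on the third derivative twice gives `Q' = O(|w|²)`, and the mean value
inequality on the ball of radius `p` concludes. The increment form is needed to compare `E` at `t +
iu` and at `t`. -/
theorem exists_cubic_bound {Q : ℂ → ℂ} {r : ℝ} (hr : 0 < r)
    (hQ : DifferentiableOn ℂ Q (Metric.ball 0 r)) (h1 : deriv Q 0 = 0) (h2 : deriv (deriv Q) 0 = 0) :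
    ∃ M : ℝ, 0 ≤ M ∧ ∀ p : ℝ, p ≤ r / 2 → ∀ w ∈ Metric.closedBall (0 : ℂ) p,
      ∀ h ∈ Metric.closedBall (0 : ℂ) p, ‖Q w - Q h‖ ≤ M * p ^ 2 * ‖w - h‖ := by
  have hU : IsOpen (Metric.ball (0 : ℂ) r) := Metric.isOpen_ball
  have hsub : Metric.closedBall (0 : ℂ) (r / 2) ⊆ Metric.ball 0 r :=
    Metric.closedBall_subset_ball (by linarith)
  have hQ1 := hQ.deriv hU
  have hQ2 := hQ1.deriv hU
  obtain ⟨M, hM⟩ := (isCompact_closedBall (0 : ℂ) (r / 2)).exists_bound_of_continuousOn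
    ((hQ2.deriv hU).continuousOn.mono hsub)
  have hM0 : 0 ≤ M := (norm_nonneg _).trans (hM 0 (by simp; positivity))
  have mean {f : ℂ → ℂ} (hf : DifferentiableOn ℂ f (Metric.ball 0 r)) {p C : ℝ} (hp : p ≤ r / 2)
      (hC : ∀ w ∈ Metric.closedBall (0 : ℂ) p, ‖deriv f w‖ ≤ C) {w h : ℂ}
      (hw : w ∈ Metric.closedBall (0 : ℂ) p) (hh : h ∈ Metric.closedBall (0 : ℂ) p) :
      ‖f w - f h‖ ≤ C * ‖w - h‖ :=
    Convex.norm_image_sub_le_of_norm_deriv_le (𝕜 := ℂ)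
      (fun x hx ↦ hf.differentiableAt (hU.mem_nhds (hsub (Metric.closedBall_subset_closedBall hp hx))))
      hC (convex_closedBall _ _) hh hw
  have b2 (w : ℂ) (hw : ‖w‖ ≤ r / 2) : ‖deriv (deriv Q) w‖ ≤ M * ‖w‖ := by
    simpa [h2] using mean hQ2 le_rfl hM (w := w) (h := 0) (by simpa using hw) (by simp; positivity)
  have b1 (w : ℂ) (hw : ‖w‖ ≤ r / 2) : ‖deriv Q w‖ ≤ M * ‖w‖ ^ 2 := by
    have := mean hQ1 hw (C := M * ‖w‖) (w := w) (h := 0) (fun v hv ↦ by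
      have hv' : ‖v‖ ≤ ‖w‖ := by simpa using hv
      exact (b2 v (hv'.trans hw)).trans (by gcongr)) (by simp) (by simp)
    simp only [h1, sub_zero] at this
    linarith
  refine ⟨M, hM0, fun p hp w hw h hh ↦ mean hQ hp (fun v hv ↦ ?_) hw hh⟩
  have hv' : ‖v‖ ≤ p := by simpa using hv
  exact (b1 v (hv'.trans hp)).trans (by gcongr)

theorem lipschitz_of_bounded_holomorphic {f : ℂ → ℂ} {r c : ℝ} (hr : 0 < r)
    (hf : DifferentiableOn ℂ f (Metric.ball 0 r)) (hc : ∀ z ∈ Metric.ball (0 : ℂ) r, ‖f z‖ ≤ c)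
    {w h : ℂ} (hw : ‖w‖ ≤ r / 2) (hh : ‖h‖ ≤ r / 2) : ‖f w - f h‖ ≤ 4 * c / r * ‖w - h‖ := by
  have hsub (x : ℂ) (hx : x ∈ Metric.closedBall (0 : ℂ) (r / 2)) :
      Metric.ball x (r / 2) ⊆ Metric.ball 0 r := by
    refine Metric.ball_subset_ball' ?_
    linarith [Metric.mem_closedBall.1 hx]
  refine Convex.norm_image_sub_le_of_norm_deriv_le (𝕜 := ℂ) (s := Metric.closedBall 0 (r / 2))
    (fun x hx ↦ hf.differentiableAt (Metric.isOpen_ball.mem_nhds (hsub x hx (by simp [hr]))))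
    (fun x hx ↦ ?_) (convex_closedBall _ _) (by simpa using hh) (by simpa using hw)
  refine (norm_deriv_le_of_ball (show 0 < r / 2 by linarith) (hf.mono (hsub x hx))
    fun z hz ↦ hc z (hsub x hx hz)).1.trans (le_of_eq ?_)
  field_simp
  ring

theorem deriv_sub_quadratic {Λ : ℂ → ℂ} {U : Set ℂ} (hU : IsOpen U) (h0 : (0 : ℂ) ∈ U)
    (hΛ : DifferentiableOn ℂ Λ U) {a b : ℂ} (h1 : deriv Λ 0 = a) (h2 : deriv (deriv Λ) 0 = b) :
    deriv (fun w ↦ Λ w - a * w - b * w ^ 2 / 2) 0 = 0 ∧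
      deriv (deriv (fun w ↦ Λ w - a * w - b * w ^ 2 / 2)) 0 = 0 := by
  have hd (z : ℂ) (hz : z ∈ U) : deriv (fun w ↦ Λ w - a * w - b * w ^ 2 / 2) z =
      deriv Λ z - a - b * z := by
    have h := (((hΛ.differentiableAt (hU.mem_nhds hz)).hasDerivAt.fun_sub
      ((hasDerivAt_id' z).const_mul a)).fun_sub
      ((((hasDerivAt_id' z).fun_pow 2).const_mul b).div_const 2))
    rw [h.deriv]
    norm_num
    ring
  refine ⟨by rw [hd 0 h0, h1]; simp, ?_⟩
  have he : deriv (fun w ↦ Λ w - a * w - b * w ^ 2 / 2) =ᶠ[nhds 0] fun z ↦ deriv Λ z - a - b * z := by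
    filter_upwards [hU.mem_nhds h0] with z hz using hd z hz
  rw [he.deriv_eq]
  have h := ((((hΛ.deriv hU).differentiableAt (hU.mem_nhds h0)).hasDerivAt.sub_const a).fun_sub
    ((hasDerivAt_id' (0 : ℂ)).const_mul b))
  rw [h.deriv, h2]
  simp

/-- With `q = n^(1/6)` one has `√n = q³`, so the third bound, on `|t|³/√n`, is what fixes the
exponent 1/6. -/
theorem moderate_scale_bounds {K n t : ℝ} (hK : 0 < K) (hn : 1 ≤ n) (ht : |t| ≤ K * n ^ (1 / 6 : ℝ)) :
    |t| / √n ≤ K / n ^ (1 / 3 : ℝ) ∧ (1 + t ^ 2) / √n ≤ 1 + K ^ 2 ∧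
      |t| * (1 + t ^ 2) / √n ≤ K + K ^ 3 := by
  have hn0 : 0 < n := by linarith
  set q := n ^ (1 / 6 : ℝ) with hq
  have hq1 : 1 ≤ q := Real.one_le_rpow hn (by norm_num)
  have hq0 : 0 < q := by linarith
  have e3 : √n = q ^ 3 := by
    rw [hq, ← Real.rpow_natCast, ← Real.rpow_mul hn0.le, Real.sqrt_eq_rpow]
    norm_num
  have e2 : n ^ (1 / 3 : ℝ) = q ^ 2 := by
    rw [hq, ← Real.rpow_natCast, ← Real.rpow_mul hn0.le]
    norm_num
  have ht2 : t ^ 2 ≤ K ^ 2 * q ^ 2 := by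
    rw [← sq_abs, ← mul_pow]; gcongr
  have hq23 : q ^ 2 ≤ q ^ 3 := pow_le_pow_right₀ hq1 (by norm_num)
  have hq3 : 1 ≤ q ^ 3 := one_le_pow₀ hq1
  have hq13 : q ≤ q ^ 3 := le_self_pow₀ hq1 (by norm_num)
  rw [e3, e2]
  refine ⟨?_, ?_, ?_⟩
  · rw [div_le_div_iff₀ (by positivity) (by positivity)]
    calc |t| * q ^ 2 ≤ K * q * q ^ 2 := by gcongr
      _ = _ := by ring
  · rw [div_le_iff₀ (by positivity)]
    nlinarith [sq_nonneg K]
  · rw [div_le_iff₀ (by positivity)]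
    calc |t| * (1 + t ^ 2) ≤ K * q * (1 + K ^ 2 * q ^ 2) := by gcongr
      _ = K * q + K ^ 3 * q ^ 3 := by ring
      _ ≤ K * q ^ 3 + K ^ 3 * q ^ 3 := by gcongr
      _ = _ := by ring

theorem two_mul_add_le {m l x y : ℝ} (hm : 0 ≤ m) (hl : 0 ≤ l) (hx : 0 ≤ x) (hy : 0 ≤ y) :
    m * (2 * (x + y)) + l ≤ (2 * m + l + 1) * (1 + x + y) := by
  nlinarith [mul_nonneg hl hx, mul_nonneg hl hy]

section Cramer

variable {Ω : Type*} [MeasurableSpace Ω]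

theorem integral_exp_standardized {P : Measure Ω} {X : Ω → ℝ} (hX : Measurable X)
    {a s t : ℝ} (z : ℂ) :
    ∫ x, Complex.exp (z * x) ∂(P.map fun ω ↦ (X ω - a) / s - t) =
      Complex.exp (-z * (a / s + t)) * ∫ ω, Complex.exp (z / s * X ω) ∂P := by
  rw [integral_map (by fun_prop) (by fun_prop), ← integral_const_mul]
  congr 1 with ω
  rw [← Complex.exp_add]
  push_cast
  congr 1
  ring

variable {P : ℕ → Measure Ω} [∀ N, IsProbabilityMeasure (P N)] {X : ℕ → Ω → ℝ}
  {r α σ c : ℝ} {Λ : ℂ → ℂ} {R : ℕ → ℂ → ℂ}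

set_option maxHeartbeats 1000000 in
/-- Moderate deviations in the zone `|t| ≤ K N ^ (1 / 6)` for a sequence of random variables whose
moment generating functions are quasi-powers. -/
theorem cramer_of_quasi_power (hX : ∀ N, Measurable (X N))
    (hXb : ∀ N, ∃ B, ∀ᵐ ω ∂(P N), |X N ω| ≤ B) (hr : 0 < r) (hσ : 0 < σ)
    (hΛ : DifferentiableOn ℂ Λ (Metric.ball 0 r)) (hΛ0 : Λ 0 = 0) (hΛ1 : deriv Λ 0 = α)
    (hΛ2 : deriv (deriv Λ) 0 = (σ : ℂ) ^ 2)
    (hR : ∀ N, DifferentiableOn ℂ (R N) (Metric.ball 0 r)) (hR0 : ∀ N, R N 0 = 0)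
    (hRc : ∀ N, ∀ z ∈ Metric.ball (0 : ℂ) r, ‖R N z‖ ≤ c)
    (hM : ∀ N, ∀ z ∈ Metric.ball (0 : ℂ) r,
      ∫ ω, Complex.exp (z * X N ω) ∂(P N) = Complex.exp (N * Λ z + R N z))
    {K : ℝ} (hK : 0 < K) :
    ∃ C : ℝ, ∀ N : ℕ, 1 ≤ N → ∀ t : ℝ, |t| ≤ K * (N : ℝ) ^ (1 / 6 : ℝ) →
      |(P N).real {ω | (X N ω - α * N) / (σ * √(N : ℝ)) ≤ t} - (gaussianReal 0 1).real (Set.Iic t)| ≤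
        C * ((1 + t ^ 2) * Real.exp (-t ^ 2 / 2) / √(N : ℝ)) := by
  have h0 : (0 : ℂ) ∈ Metric.ball (0 : ℂ) r := by simp [hr]
  have hc : 0 ≤ c := (norm_nonneg _).trans (hRc 0 0 h0)
  set Q : ℂ → ℂ := fun w ↦ Λ w - α * w - (σ : ℂ) ^ 2 * w ^ 2 / 2 with hQdef
  have hQd : DifferentiableOn ℂ Q (Metric.ball 0 r) := by
    refine (hΛ.sub ?_).sub ?_ <;> fun_prop
  obtain ⟨hQ1, hQ2⟩ := deriv_sub_quadratic Metric.isOpen_ball h0 hΛ hΛ1 hΛ2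
  obtain ⟨M, hM0, hMQ⟩ := exists_cubic_bound hr hQd hQ1 hQ2
  set L := 4 * c / r with hL
  have hL0 : 0 ≤ L := by positivity
  -- `A₁` bounds the increments of `E`: the cubic term of `N Λ` contributes `2M/σ²` and the
  -- remainder `R N` contributes `L`.
  set A₁ := 2 * M / σ ^ 2 + L + 1 with hA₁
  have hA₁0 : 0 < A₁ := by positivity
  -- The frequency cutoff is `T = c₁ s`. The first bound makes the cubic error at most `u²/8`; the
  -- second keeps `|u|/s ≤ r/4`, so that with `|t|/s ≤ r/4` the argument stays within radius `r/2`.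
  set c₁ := min (1 / (8 * A₁)) (r / 4) with hc₁
  have hc₁0 : 0 < c₁ := lt_min (by positivity) (by positivity)
  have hc₁A : A₁ * c₁ ≤ 1 / 8 := by
    calc A₁ * c₁ ≤ A₁ * (1 / (8 * A₁)) := by gcongr; exact min_le_left _ _
      _ = 1 / 8 := by field_simp
  set A := 2 * (A₁ * (1 + K ^ 2) / σ) ^ 2 + A₁ * (K + K ^ 3) / σ with hA
  obtain ⟨C, hC, hmain⟩ := abs_cdf_sub_gaussian_le_of_laplace A
  obtain ⟨N₀, hN₀⟩ : ∃ N₀ : ℕ, ∀ N : ℕ, N₀ ≤ N → 1 ≤ N → K / (N : ℝ) ^ (1 / 3 : ℝ) ≤ σ * (r / 4) := by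
    have : Filter.Tendsto (fun N : ℕ ↦ K / (N : ℝ) ^ (1 / 3 : ℝ)) Filter.atTop (nhds 0) :=
      ((tendsto_rpow_atTop (by norm_num)).comp tendsto_natCast_atTop_atTop).const_div_atTop K
    obtain ⟨N₀, h⟩ := Filter.eventually_atTop.1
      (this.eventually (gt_mem_nhds (show 0 < σ * (r / 4) by positivity)))
    exact ⟨N₀, fun N hN _ ↦ (h N hN).le⟩
  -- The second summand handles `N < N₀`, where the difference of probabilities is at most 1 and `t`
  -- is bounded by `K N₀`.
  refine ⟨C * (A₁ + 1 / c₁) / σ + √(N₀ : ℝ) * Real.exp ((K * N₀) ^ 2 / 2), fun N hN t ht ↦ ?_⟩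
  have hNr : (1 : ℝ) ≤ N := by exact_mod_cast hN
  have hsN : 0 < √(N : ℝ) := Real.sqrt_pos.2 (by linarith)
  rcases lt_or_ge N N₀ with hlt | hge
  · have hN₀r : (N : ℝ) ≤ N₀ := by exact_mod_cast hlt.le
    have h1 : |(P N).real {ω | (X N ω - α * N) / (σ * √(N : ℝ)) ≤ t} -
        (gaussianReal 0 1).real (Set.Iic t)| ≤ 1 := by
      rw [abs_le]
      constructor <;> linarith [measureReal_nonneg (μ := P N)
        (s := {ω | (X N ω - α * N) / (σ * √(N : ℝ)) ≤ t}),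
        measureReal_le_one (μ := P N) (s := {ω | (X N ω - α * N) / (σ * √(N : ℝ)) ≤ t}),
        measureReal_nonneg (μ := gaussianReal 0 1) (s := Set.Iic t),
        measureReal_le_one (μ := gaussianReal 0 1) (s := Set.Iic t)]
    refine h1.trans ?_
    have h2 : |t| ≤ K * N₀ := by
      refine ht.trans (mul_le_mul_of_nonneg_left ?_ hK.le)
      refine le_trans ?_ hN₀r
      conv_rhs => rw [← Real.rpow_one (N : ℝ)]
      exact Real.rpow_le_rpow_of_exponent_le hNr (by norm_num)
    have h3 : t ^ 2 ≤ (K * N₀) ^ 2 := by rw [← sq_abs]; gcongr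
    have h4 : 1 ≤ √(N₀ : ℝ) / √(N : ℝ) := by
      rw [one_le_div hsN]; exact Real.sqrt_le_sqrt hN₀r
    have h5 : 1 ≤ Real.exp ((K * N₀) ^ 2 / 2) * Real.exp (-t ^ 2 / 2) := by
      rw [← Real.exp_add]; exact Real.one_le_exp (by linarith)
    calc (1 : ℝ) ≤ (√(N₀ : ℝ) / √(N : ℝ)) * (Real.exp ((K * N₀) ^ 2 / 2) * Real.exp (-t ^ 2 / 2)) *
          (1 + t ^ 2) := by
          refine one_le_mul_of_one_le_of_one_le (one_le_mul_of_one_le_of_one_le h4 h5) ?_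
          linarith [sq_nonneg t]
      _ = √(N₀ : ℝ) * Real.exp ((K * N₀) ^ 2 / 2) *
          ((1 + t ^ 2) * Real.exp (-t ^ 2 / 2) / √(N : ℝ)) := by ring
      _ ≤ _ := by
          gcongr
          rw [le_add_iff_nonneg_left]
          positivity
  · obtain ⟨hs1, hs2, hs3⟩ := moderate_scale_bounds hK hNr ht
    set s := σ * √(N : ℝ) with hs
    have hs0 : 0 < s := by positivity
    have hss : s ^ 2 = σ ^ 2 * N := by rw [hs, mul_pow, Real.sq_sqrt (by linarith)]
    have hts : |t| / s ≤ r / 4 := by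
      rw [hs, mul_comm, ← div_div, div_le_iff₀ hσ]
      linarith [hs1.trans (hN₀ N hge hN)]
    have hts2 : (1 + t ^ 2) / s ≤ (1 + K ^ 2) / σ := by
      rw [hs, mul_comm, ← div_div]; gcongr
    have hts3 : |t| * (1 + t ^ 2) / s ≤ (K + K ^ 3) / σ := by
      rw [hs, mul_comm σ, ← div_div]; gcongr
    -- After standardization the linear and quadratic parts of `N Λ` become the drift and `z²/2`;
    -- `E` collects the rest.
    set E : ℂ → ℂ := fun z ↦ N * Q (z / s) + R N (z / s) with hE
    obtain ⟨B, hB⟩ := hXb N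
    have hmeas : Measurable fun ω ↦ (X N ω - α * N) / s - t := by
      have := hX N
      fun_prop
    have : IsProbabilityMeasure ((P N).map fun ω ↦ (X N ω - α * N) / s - t) :=
      Measure.isProbabilityMeasure_map hmeas.aemeasurable
    have hnorm (u : ℝ) : ‖((t : ℂ) + u * Complex.I) / s‖ ≤ (|t| + |u|) / s := by
      rw [norm_div, Complex.norm_real, Real.norm_of_nonneg hs0.le]
      gcongr
      refine (norm_add_le _ _).trans (le_of_eq ?_)
      simp
    have hdiff {z y : ℂ} {p : ℝ} (hp : p ≤ r / 2) (hz : ‖z / s‖ ≤ p) (hy : ‖y / s‖ ≤ p) :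
        ‖E z - E y‖ ≤ ‖z - y‖ / s * (N * M * p ^ 2 + L) := by
      have h1 := hMQ p hp (z / s) (by simpa using hz) (y / s) (by simpa using hy)
      have h2 := lipschitz_of_bounded_holomorphic hr (hR N) (hRc N) (hz.trans hp) (hy.trans hp)
      have h3 : ‖z / s - y / s‖ = ‖z - y‖ / s := by
        rw [← sub_div, norm_div, Complex.norm_real, Real.norm_of_nonneg hs0.le]
      rw [h3] at h1 h2
      rw [hE, show (N * Q (z / s) + R N (z / s)) - (N * Q (y / s) + R N (y / s)) =
        N * (Q (z / s) - Q (y / s)) + (R N (z / s) - R N (y / s)) by ring]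
      refine (norm_add_le _ _).trans ?_
      rw [norm_mul, Complex.norm_natCast]
      calc _ ≤ N * (M * p ^ 2 * (‖z - y‖ / s)) + L * (‖z - y‖ / s) := by gcongr
        _ = _ := by ring
    have hpN (v : ℝ) : N * M * (v / s) ^ 2 = M / σ ^ 2 * v ^ 2 := by
      rw [div_pow, hss]
      have : (N : ℝ) ≠ 0 := by positivity
      field_simp
    have hE0 : E 0 = 0 := by simp [hE, hQdef, hΛ0, hR0]
    have hE1 (u : ℝ) (hu : |u| ≤ c₁ * s) :
        ‖E (t + u * Complex.I) - E t‖ ≤ |u| * (A₁ / s * (1 + t ^ 2 + u ^ 2)) := by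
      have hu' : |u| / s ≤ r / 4 := by
        rw [div_le_iff₀ hs0]
        exact hu.trans (by gcongr; exact min_le_right _ _)
      have h1 := hdiff (z := t + u * Complex.I) (y := t) (p := (|t| + |u|) / s)
        (by rw [add_div]; linarith) (hnorm u) (by
          have := hnorm 0
          simp only [Complex.ofReal_zero, zero_mul, add_zero, abs_zero] at this
          exact this.trans (by gcongr; linarith [abs_nonneg u]))
      rw [hpN] at h1
      have h2 : ‖(t : ℂ) + u * Complex.I - t‖ = |u| := by simp
      rw [h2] at h1
      refine h1.trans ?_
      have h3 : (|t| + |u|) ^ 2 ≤ 2 * (t ^ 2 + u ^ 2) := by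
        nlinarith [sq_nonneg (|t| - |u|), sq_abs t, sq_abs u]
      have h4 : M / σ ^ 2 * (|t| + |u|) ^ 2 + L ≤ A₁ * (1 + t ^ 2 + u ^ 2) := by
        have h5 : M / σ ^ 2 * (|t| + |u|) ^ 2 ≤ M / σ ^ 2 * (2 * (t ^ 2 + u ^ 2)) := by gcongr
        rw [hA₁, mul_div_assoc]
        exact (add_le_add h5 le_rfl).trans
          (two_mul_add_le (by positivity) hL0 (sq_nonneg t) (sq_nonneg u))
      calc _ ≤ |u| / s * (A₁ * (1 + t ^ 2 + u ^ 2)) := by gcongr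
        _ = _ := by ring
    have hEt : ‖E t‖ ≤ A₁ / s * (1 + t ^ 2) * |t| := by
      have h1 := hdiff (z := t) (y := 0) (p := |t| / s) (by linarith) (by
          simpa using hnorm 0) (by simp; positivity)
      rw [hpN, hE0, sub_zero, sub_zero, Complex.norm_real, Real.norm_eq_abs, sq_abs] at h1
      refine h1.trans ?_
      have h4 : M / σ ^ 2 * t ^ 2 + L ≤ A₁ * (1 + t ^ 2) := by
        have h6 : 0 ≤ M / σ ^ 2 * t ^ 2 := by positivity
        have h7 := two_mul_add_le (show 0 ≤ M / σ ^ 2 by positivity) hL0 (sq_nonneg t) le_rfl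
        rw [hA₁, mul_div_assoc]
        linarith
      calc _ ≤ |t| / s * (A₁ * (1 + t ^ 2)) := by gcongr
        _ = _ := by ring
    have hAs : A₁ / s * (1 + t ^ 2) ≤ A₁ * (1 + K ^ 2) / σ := by
      calc _ = A₁ * ((1 + t ^ 2) / s) := by ring
        _ ≤ A₁ * ((1 + K ^ 2) / σ) := by gcongr
        _ = _ := by ring
    have key := hmain ((P N).map fun ω ↦ (X N ω - α * N) / s - t) ((B + |α * N|) / s + |t|) t
      (A₁ / s) (c₁ * s) E ?_ (by positivity) (by positivity) ?_ hE1 ?_ hEt ?_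
    · have hset : ((P N).map fun ω ↦ (X N ω - α * N) / s - t).real (Set.Iic 0) =
          (P N).real {ω | (X N ω - α * N) / s ≤ t} := by
        rw [measureReal_def, measureReal_def, Measure.map_apply hmeas measurableSet_Iic]
        congr 2
        ext ω
        simp
      rw [hset] at key
      refine key.trans ?_
      calc _ = C * (A₁ + 1 / c₁) / σ * ((1 + t ^ 2) * Real.exp (-t ^ 2 / 2) / √(N : ℝ)) := by
            rw [hs]; field_simp
        _ ≤ _ := by
            gcongr
            rw [le_add_iff_nonneg_right]
            positivity
    · rw [ae_map_iff hmeas.aemeasurable (measurableSet_le (by fun_prop) measurable_const)]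
      filter_upwards [hB] with ω hω
      refine (abs_sub _ _).trans ?_
      rw [abs_div, abs_of_pos hs0]
      gcongr
      exact (abs_sub _ _).trans (by gcongr)
    · intro u hu
      have hball : ((t : ℂ) + u * Complex.I) / s ∈ Metric.ball (0 : ℂ) r := by
        rw [mem_ball_zero_iff]
        refine (hnorm u).trans_lt ?_
        have hu' : |u| / s ≤ r / 4 := by
          rw [div_le_iff₀ hs0]
          exact hu.trans (by gcongr; exact min_le_right _ _)
        rw [add_div]
        linarith
      rw [integral_exp_standardized (hX N), hM N _ hball, ← Complex.exp_add]
      congr 1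
      generalize (t : ℂ) + u * Complex.I = z
      have hssC : (s : ℂ) ^ 2 = (σ : ℂ) ^ 2 * N := by exact_mod_cast hss
      have e : (N : ℂ) * ((σ : ℂ) ^ 2 * (z / s) ^ 2 / 2) = z ^ 2 / 2 := by
        have hσC : (σ : ℂ) ≠ 0 := by exact_mod_cast hσ.ne'
        have hNC : (N : ℂ) ≠ 0 := by exact_mod_cast (Nat.one_le_iff_ne_zero.1 hN)
        rw [div_pow, hssC]
        field_simp
      simp only [hE, hQdef, mul_sub, e]
      push_cast
      ring
    · intro u hu
      refine (hE1 u hu).trans ?_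
      set κ := A₁ * (1 + K ^ 2) / σ with hκ
      have h1 : |u| * (A₁ / s * (1 + t ^ 2 + u ^ 2)) =
          |u| * (A₁ / s * (1 + t ^ 2)) + A₁ * (|u| / s) * u ^ 2 := by ring
      have h2 : |u| / s ≤ c₁ := by rwa [div_le_iff₀ hs0]
      have h3 : A₁ * (|u| / s) * u ^ 2 ≤ 1 / 8 * u ^ 2 := by
        gcongr
        exact (mul_le_mul_of_nonneg_left h2 hA₁0.le).trans hc₁A
      have h4 : |u| * (A₁ / s * (1 + t ^ 2)) ≤ |u| * κ := by gcongr
      -- The linear term is absorbed by the inequality of arithmetic and geometric means into the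
      -- remaining `u²/8`.
      have h5 : |u| * κ ≤ 2 * κ ^ 2 + 1 / 8 * u ^ 2 := by
        nlinarith [sq_nonneg (4 * κ - |u|), sq_abs u]
      have h6 : 0 ≤ A₁ * (K + K ^ 3) / σ := by positivity
      rw [h1, hA]
      linarith
    · refine hEt.trans ?_
      calc _ = A₁ * (|t| * (1 + t ^ 2) / s) := by ring
        _ ≤ A₁ * ((K + K ^ 3) / σ) := by gcongr
        _ = A₁ * (K + K ^ 3) / σ := by ring
        _ ≤ A := by rw [hA, le_add_iff_nonneg_left]; positivity

end Cramer

theorem gaussianReal_std_real_Iic (t : ℝ) : (gaussianReal 0 1).real (Set.Iic t) =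
    ∫ v in Set.Iic t, Real.exp (-v ^ 2 / 2) / √(2 * Real.pi) := by
  simp only [gaussianReal_std_real, gaussianPDFReal_std]

theorem theorem1 :
    ∃ α σ : ℝ, 0 < α ∧ 0 < σ ∧
      (∀ K : ℝ, 0 < K → ∃ C : ℝ, ∀ N : ℕ, 1 ≤ N → ∀ t : ℝ, |t| ≤ K * (N : ℝ) ^ (1 / 6 : ℝ) →
        |(dyadicUniform N).real {n : ℕ | (logStern n - α * N) / (σ * √(N : ℝ)) ≤ t}
            - ∫ v in Set.Iic t, Real.exp (-v ^ 2 / 2) / √(2 * Real.pi)|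
          ≤ C * ((1 + t ^ 2) * Real.exp (-t ^ 2 / 2) / √(N : ℝ))) ∧
      ∃ ν₁ ν₂ θ : ℝ, 0 ≤ θ ∧ θ < 1 ∧
        (∃ C : ℝ, ∀ N : ℕ, 1 ≤ N →
          |(∫ n, logStern n ∂(dyadicUniform N)) - (α * N + ν₁)| ≤ C * θ ^ N) ∧
        (∃ C : ℝ, ∀ N : ℕ, 1 ≤ N →
          |variance logStern (dyadicUniform N) - (σ ^ 2 * N + ν₂)| ≤ C * (N * θ ^ N)) := by
  obtain ⟨α, σ, ν₁, ν₂, C, Λ, R, hα, hσ, hmean, hvar, hΛ, hΛ0, hΛ1, hΛ2, hR, hR0, hRc, hM⟩ :=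
    logStern_quasi_power
  have hC : 0 ≤ C := (norm_nonneg _).trans (hRc 0 0 (by simp))
  refine ⟨α, σ, hα, hσ, fun K hK ↦ ?_, ν₁, ν₂, 4 / 5, by norm_num, by norm_num,
    ⟨C, fun N _ ↦ hmean N⟩, C, fun N hN ↦ (hvar N).trans ?_⟩
  · simp only [← gaussianReal_std_real_Iic]
    exact cramer_of_quasi_power (P := dyadicUniform) (X := fun _ ↦ logStern)
      (fun _ ↦ measurable_of_countable _) logStern_ae_bounded (by norm_num) hσ hΛ hΛ0 hΛ1 hΛ2 hR hR0
      hRc hM hK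
  -- The variance error is already `O(θ^N)`; the factor `N ≥ 1` only weakens it.
  · have hNr : (1 : ℝ) ≤ N := by exact_mod_cast hN
    refine mul_le_mul_of_nonneg_left ?_ hC
    exact le_mul_of_one_le_left (by positivity) hNr
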